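/- Let $I$, $B$, $L$ be pairwise disjoint infinite sets (IRIs, blank nodes, literals), put $U=I\cup B\cup L$, and let $V$ be an infinite set of variables disjoint from $U$. An RDF graph is a finite subset of $(I\cup B)\times I\times U$. SPARQL patterns are built from triple patterns in $(I\cup L\cup V)\times(I\cup V)\times(I\cup L\cup V)$ by the binary operators UNION, AND, OPT and by $P\ \mathrm{FILTER}\ C$, where the constraint $C$ has one of the six forms $\mathrm{bound}(?x)$, $\neg\mathrm{bound}(?x)$, $?x={?y}$, $?x\neq{?y}$ (with $?x,?y$ distinct variables), $?x=c$, $?x\neq c$ (with $c\in I\cup L$); these six classes of constraints are denoted $\mathrm{bound}$, $\neg\mathrm{bound}$, $=$, $\neq$, $=_c$, $\neq_c$. For a set $F$ of classes, $\mathrm{SPARQL}(F)$ consists of the patterns all of whose filter conditions belong to a class in $F$. A mapping is a function $\mu:S\to U$ on a finite set $S=\mathrm{dom}\,\mu\subseteq V$, extended by the identity to constants $c\in I\cup L$; two mappings are compatible, $\mu_1\sim\mu_2$, if they agree on $\mathrm{dom}\,\mu_1\cap\mathrm{dom}\,\mu_2$. For sets of mappings, $\Omega_1\Join\Omega_2=\{\mu_1\cup\mu_2\mid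 \mu_i\in\Omega_i,\ \mu_1\sim\mu_2\}$ and $\Omega_1\smallsetminus\Omega_2=\{\mu_1\in\Omega_1\mid\neg\exists\mu_2\in\Omega_2:\mu_1\sim\mu_2\}$. On a graph $G$, the semantics is: $[\![(u,v,w)]\!]_G$ is the set of mappings $\mu$ with domain $\{u,v,w\}\cap V$ and $(\mu(u),\mu(v),\mu(w))\in G$; UNION is union; AND is $\Join$; $[\![P_1\,\mathrm{OPT}\,P_2]\!]_G=([\![P_1]\!]_G\Join[\![P_2]\!]_G)\cup([\![P_1]\!]_G\smallsetminus[\![P_2]\!]_G)$; and $[\![P\,\mathrm{FILTER}\,C]\!]_G$ consists of the $\mu\in[\![P]\!]_G$ that satisfy $C$, where $\mathrm{bound}(?x)$ means $?x\in\mathrm{dom}\,\mu$, $\neg\mathrm{bound}(?x)$ means $?x\notin\mathrm{dom}\,\mu$, and an equality or nonequality holds if all its variables are in $\mathrm{dom}\,\mu$ and the values are equal, respectively different. A pattern $P$ is satisfiable if $[\![P]\!]_G\neq\emptyset$ for some RDF graph $G$. As inputs of algorithms, IRIs, literals and variables are named by finite binary strings, and a pattern is written as the postfix listing of its syntax tree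 over a fixed finite alphabet. Then the satisfiability problem for $\mathrm{SPARQL}(\mathrm{bound},=,\neq_c)$ patterns (the language of the codes of all satisfiable patterns of that fragment) is in NP, and so is the satisfiability problem for $\mathrm{SPARQL}(\mathrm{bound},\neq,\neq_c)$ patterns. -/

import Mathlib

namespace SPARQL

/-! ## RDF graphs -/

/-- The set `U = I ∪ B ∪ L` of RDF terms, a disjoint union. -/
inductive RDFTerm (I B L : Type*)
  | iri (i : I)
  | blank (b : B)
  | lit (l : L)

/-- `(s, p, o)` lies in `(I ∪ B) × I × U`. -/
def IsRDFTriple {I B L : Type*} (t : RDFTerm I B L × RDFTerm I B L × RDFTerm I B L) : Prop :=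
  (∀ l, t.1 ≠ .lit l) ∧ ∃ i, t.2.1 = .iri i

/-- An RDF graph: a finite set of RDF triples. -/
structure RDFGraph (I B L : Type*) where
  triples : Set (RDFTerm I B L × RDFTerm I B L × RDFTerm I B L)
  finite_triples : triples.Finite
  isRDFTriple : ∀ t ∈ triples, IsRDFTriple t

/-! ## Syntax of patterns -/

/-- A constant: an element of `I ∪ L`. -/
inductive Const (I L : Type*)
  | iri (i : I)
  | lit (l : L)

/-- An element of `I ∪ L ∪ V`, allowed in subject and object position of a triple pattern. -/
inductive PTerm (I L V : Type*)
  | iri (i : I)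
  | lit (l : L)
  | var (x : V)

/-- An element of `I ∪ V`, allowed in predicate position of a triple pattern. -/
inductive PredTerm (I V : Type*)
  | iri (i : I)
  | var (x : V)

/-- The inclusion `I ∪ V ⊆ I ∪ L ∪ V`. -/
def PredTerm.toPTerm {I L V : Type*} : PredTerm I V → PTerm I L V
  | .iri i => .iri i
  | .var x => .var x

/-- The inclusion `I ∪ L ⊆ I ∪ L ∪ V`. -/
def Const.toPTerm {I L V : Type*} : Const I L → PTerm I L V
  | .iri i => .iri i
  | .lit l => .lit l

/-- Filter conditions; the two variables of a nonequality are distinct. -/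
inductive Constraint (I L V : Type*)
  | bound (x : V)
  | notBound (x : V)
  | eq (x y : V)
  | ne (x y : V) (h : x ≠ y)
  | eqConst (x : V) (c : Const I L)
  | neConst (x : V) (c : Const I L)

/-- SPARQL patterns. -/
inductive Pattern (I L V : Type*)
  | triple (u : PTerm I L V) (v : PredTerm I V) (w : PTerm I L V)
  | union (P₁ P₂ : Pattern I L V)
  | and (P₁ P₂ : Pattern I L V)
  | opt (P₁ P₂ : Pattern I L V)
  | filter (P : Pattern I L V) (C : Constraint I L V)

/-! ## Semantics of patterns -/

/-- A solution mapping: a function to `U` defined on a finite set of variables,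
with value `none` outside its domain. -/
@[ext] structure Mapping (I B L V : Type*) where
  toFun : V → Option (RDFTerm I B L)
  finite_dom : {x | toFun x ≠ none}.Finite

namespace Mapping

variable {I B L V : Type*}

/-- The domain of a mapping. -/
def dom (μ : Mapping I B L V) : Set V := {x | μ.toFun x ≠ none}

/-- The value of a mapping on an element of `I ∪ L ∪ V`: mappings are the identity
on constants, and undefined on variables outside the domain. -/
def eval (μ : Mapping I B L V) : PTerm I L V → Option (RDFTerm I B L)
  | .iri i => some (.iri i)
  | .lit l => some (.lit l)
  | .var x => μ.toFun x

/-- Compatibility: agreement on the intersection of the domains. -/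
def Compatible (μ₁ μ₂ : Mapping I B L V) : Prop :=
  ∀ x, x ∈ μ₁.dom → x ∈ μ₂.dom → μ₁.toFun x = μ₂.toFun x

/-- The union of two mappings (used for compatible mappings only). -/
def union (μ₁ μ₂ : Mapping I B L V) : Mapping I B L V where
  toFun x := (μ₁.toFun x).or (μ₂.toFun x)
  finite_dom := (μ₁.finite_dom.union μ₂.finite_dom).subset fun x hx => by
    by_contra h
    simp only [Set.mem_union, Set.mem_ofPred_eq, not_or, not_not] at h
    simp [h.1, h.2] at hx

/-- Satisfaction `μ ⊨ C` of a constraint by a mapping. -/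
def Satisfies (μ : Mapping I B L V) : Constraint I L V → Prop
  | .bound x => x ∈ μ.dom
  | .notBound x => x ∉ μ.dom
  | .eq x y => x ∈ μ.dom ∧ y ∈ μ.dom ∧ μ.toFun x = μ.toFun y
  | .ne x y _ => x ∈ μ.dom ∧ y ∈ μ.dom ∧ μ.toFun x ≠ μ.toFun y
  | .eqConst x c => x ∈ μ.dom ∧ μ.toFun x = μ.eval c.toPTerm
  | .neConst x c => x ∈ μ.dom ∧ μ.toFun x ≠ μ.eval c.toPTerm

end Mapping

/-- `Ω₁ ⋈ Ω₂`. -/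
def join {I B L V : Type*} (Ω₁ Ω₂ : Set (Mapping I B L V)) : Set (Mapping I B L V) :=
  {μ | ∃ μ₁ ∈ Ω₁, ∃ μ₂ ∈ Ω₂, μ₁.Compatible μ₂ ∧ μ = μ₁.union μ₂}

/-- `Ω₁ ∖ Ω₂`: the mappings of `Ω₁` that are compatible with no mapping of `Ω₂`. -/
def minus {I B L V : Type*} (Ω₁ Ω₂ : Set (Mapping I B L V)) : Set (Mapping I B L V) :=
  {μ₁ | μ₁ ∈ Ω₁ ∧ ¬ ∃ μ₂ ∈ Ω₂, μ₁.Compatible μ₂}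

/-- The set of variables occurring in an element of `I ∪ L ∪ V`. -/
def PTerm.vars {I L V : Type*} : PTerm I L V → Set V
  | .iri _ => ∅
  | .lit _ => ∅
  | .var x => {x}

/-- The semantics `⟦P⟧_G` of a pattern on a graph. -/
def sem {I B L V : Type*} (G : RDFGraph I B L) : Pattern I L V → Set (Mapping I B L V)
  | .triple u v w =>
      {μ | μ.dom = u.vars ∪ (v.toPTerm : PTerm I L V).vars ∪ w.vars ∧
        ∃ s p o, μ.eval u = some s ∧ μ.eval v.toPTerm = some p ∧ μ.eval w = some o ∧
          (s, p, o) ∈ G.triples}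
  | .union P₁ P₂ => sem G P₁ ∪ sem G P₂
  | .and P₁ P₂ => join (sem G P₁) (sem G P₂)
  | .opt P₁ P₂ => join (sem G P₁) (sem G P₂) ∪ minus (sem G P₁) (sem G P₂)
  | .filter P C => {μ | μ ∈ sem G P ∧ μ.Satisfies C}

/-- `P` is satisfiable: some RDF graph (with blank nodes from `B`) gives it a nonempty
set of solution mappings. -/
def Satisfiable {I L V : Type*} (B : Type*) (P : Pattern I L V) : Prop :=
  ∃ G : RDFGraph I B L, (sem G P).Nonempty

/-! ## Fragments -/

/-- The six classes of constraints. -/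
inductive ConstraintClass
  | bound
  | notBound
  | eq
  | ne
  | eqConst
  | neConst

/-- The class of a constraint. -/
def Constraint.cls {I L V : Type*} : Constraint I L V → ConstraintClass
  | .bound _ => .bound
  | .notBound _ => .notBound
  | .eq _ _ => .eq
  | .ne _ _ _ => .ne
  | .eqConst _ _ => .eqConst
  | .neConst _ _ => .neConst

/-- `P` belongs to the fragment `SPARQL(F)`: every filter condition of `P` is of a class in `F`. -/
def Pattern.InFragment {I L V : Type*} (F : Set ConstraintClass) : Pattern I L V → Prop
  | .triple _ _ _ => True
  | .union P₁ P₂ => P₁.InFragment F ∧ P₂.InFragment F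
  | .and P₁ P₂ => P₁.InFragment F ∧ P₂.InFragment F
  | .opt P₁ P₂ => P₁.InFragment F ∧ P₂.InFragment F
  | .filter P C => P.InFragment F ∧ C.cls ∈ F

/-! ## Patterns as strings

IRIs, literals and variables are named by arbitrary finite binary strings. A pattern is written
as a string over a finite alphabet by listing its syntax tree in postfix order; a name is written
as a symbol telling its sort followed by its bits. -/

/-- Patterns over binary names. -/
abbrev BPattern := Pattern (List Bool) (List Bool) (List Bool)

/-- The alphabet in which patterns are written. -/
inductive Sym
  | bit (b : Bool)
  | iri
  | lit
  | var
  | triple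
  | union
  | and
  | opt
  | bound
  | notBound
  | eq
  | ne
  | eqConst
  | neConst
  deriving DecidableEq, Fintype

abbrev BTerm := PTerm (List Bool) (List Bool) (List Bool)

abbrev BConstraint := Constraint (List Bool) (List Bool) (List Bool)

def encodeTerm : BTerm → List Sym
  | .iri n => .iri :: n.map .bit
  | .lit n => .lit :: n.map .bit
  | .var n => .var :: n.map .bit

def encodeConstraint : BConstraint → List Sym
  | .bound x => encodeTerm (.var x) ++ [.bound]
  | .notBound x => encodeTerm (.var x) ++ [.notBound]
  | .eq x y => encodeTerm (.var x) ++ encodeTerm (.var y) ++ [.eq]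
  | .ne x y _ => encodeTerm (.var x) ++ encodeTerm (.var y) ++ [.ne]
  | .eqConst x c => encodeTerm (.var x) ++ encodeTerm c.toPTerm ++ [.eqConst]
  | .neConst x c => encodeTerm (.var x) ++ encodeTerm c.toPTerm ++ [.neConst]

def encodePattern : BPattern → List Sym
  | .triple u v w => encodeTerm u ++ encodeTerm v.toPTerm ++ encodeTerm w ++ [.triple]
  | .union P₁ P₂ => encodePattern P₁ ++ encodePattern P₂ ++ [.union]
  | .and P₁ P₂ => encodePattern P₁ ++ encodePattern P₂ ++ [.and]
  | .opt P₁ P₂ => encodePattern P₁ ++ encodePattern P₂ ++ [.opt]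
  | .filter P C => encodePattern P ++ encodeConstraint C

/-- Entries of the parser stack. -/
inductive Item
  | term (t : BTerm)
  | pat (P : BPattern)

/-- One step of the postfix parser. -/
def parseStep : List Item → Sym → Option (List Item)
  | .term (.iri n) :: st, .bit b => some (.term (.iri (n ++ [b])) :: st)
  | .term (.lit n) :: st, .bit b => some (.term (.lit (n ++ [b])) :: st)
  | .term (.var n) :: st, .bit b => some (.term (.var (n ++ [b])) :: st)
  | st, .iri => some (.term (.iri []) :: st)
  | st, .lit => some (.term (.lit []) :: st)
  | st, .var => some (.term (.var []) :: st)
  | .term w :: .term (.iri v) :: .term u :: st, .triple => some (.pat (.triple u (.iri v) w) :: st)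
  | .term w :: .term (.var v) :: .term u :: st, .triple => some (.pat (.triple u (.var v) w) :: st)
  | .pat P₂ :: .pat P₁ :: st, .union => some (.pat (.union P₁ P₂) :: st)
  | .pat P₂ :: .pat P₁ :: st, .and => some (.pat (.and P₁ P₂) :: st)
  | .pat P₂ :: .pat P₁ :: st, .opt => some (.pat (.opt P₁ P₂) :: st)
  | .term (.var x) :: .pat P :: st, .bound => some (.pat (.filter P (.bound x)) :: st)
  | .term (.var x) :: .pat P :: st, .notBound => some (.pat (.filter P (.notBound x)) :: st)
  | .term (.var y) :: .term (.var x) :: .pat P :: st, .eq =>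
      some (.pat (.filter P (.eq x y)) :: st)
  | .term (.var y) :: .term (.var x) :: .pat P :: st, .ne =>
      if h : x ≠ y then some (.pat (.filter P (.ne x y h)) :: st) else none
  | .term (.iri c) :: .term (.var x) :: .pat P :: st, .eqConst =>
      some (.pat (.filter P (.eqConst x (.iri c))) :: st)
  | .term (.lit c) :: .term (.var x) :: .pat P :: st, .eqConst =>
      some (.pat (.filter P (.eqConst x (.lit c))) :: st)
  | .term (.iri c) :: .term (.var x) :: .pat P :: st, .neConst =>
      some (.pat (.filter P (.neConst x (.iri c))) :: st)
  | .term (.lit c) :: .term (.var x) :: .pat P :: st, .neConst =>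
      some (.pat (.filter P (.neConst x (.lit c))) :: st)
  | _, _ => none

def decodePattern (s : List Sym) : Option BPattern :=
  match s.foldlM parseStep [] with
  | some [.pat P] => some P
  | _ => none

theorem parse_bits_iri (m n : List Bool) (st : List Item) :
    (m.map Sym.bit).foldlM parseStep (.term (.iri n) :: st) =
      some (.term (.iri (n ++ m)) :: st) := by
  induction m generalizing n with
  | nil => simp
  | cons b m ih => simp [parseStep, ih]

theorem parse_bits_lit (m n : List Bool) (st : List Item) :
    (m.map Sym.bit).foldlM parseStep (.term (.lit n) :: st) =
      some (.term (.lit (n ++ m)) :: st) := by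
  induction m generalizing n with
  | nil => simp
  | cons b m ih => simp [parseStep, ih]

theorem parse_bits_var (m n : List Bool) (st : List Item) :
    (m.map Sym.bit).foldlM parseStep (.term (.var n) :: st) =
      some (.term (.var (n ++ m)) :: st) := by
  induction m generalizing n with
  | nil => simp
  | cons b m ih => simp [parseStep, ih]

theorem parse_encodeTerm (t : BTerm) (st : List Item) :
    (encodeTerm t).foldlM parseStep st = some (.term t :: st) := by
  cases t <;>
    simp [encodeTerm, parseStep, parse_bits_iri, parse_bits_lit, parse_bits_var]

theorem parse_encodeConstraint (P : BPattern) (C : BConstraint) (st : List Item) :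
    (encodeConstraint C).foldlM parseStep (.pat P :: st) = some (.pat (.filter P C) :: st) := by
  cases C with
  | bound x => simp [encodeConstraint, List.foldlM_append, parse_encodeTerm, parseStep]
  | notBound x => simp [encodeConstraint, List.foldlM_append, parse_encodeTerm, parseStep]
  | eq x y => simp [encodeConstraint, List.foldlM_append, parse_encodeTerm, parseStep]
  | ne x y h => simp [encodeConstraint, List.foldlM_append, parse_encodeTerm, parseStep, h]
  | eqConst x c =>
    cases c <;>
      simp [encodeConstraint, List.foldlM_append, parse_encodeTerm, parseStep, Const.toPTerm]
  | neConst x c =>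
    cases c <;>
      simp [encodeConstraint, List.foldlM_append, parse_encodeTerm, parseStep, Const.toPTerm]

theorem parse_encodePattern (P : BPattern) (st : List Item) :
    (encodePattern P).foldlM parseStep st = some (.pat P :: st) := by
  induction P generalizing st with
  | triple u v w =>
    cases v <;>
      simp [encodePattern, List.foldlM_append, parse_encodeTerm, parseStep, PredTerm.toPTerm]
  | union P₁ P₂ h₁ h₂ => simp [encodePattern, List.foldlM_append, parseStep, h₁, h₂]
  | and P₁ P₂ h₁ h₂ => simp [encodePattern, List.foldlM_append, parseStep, h₁, h₂]
  | opt P₁ P₂ h₁ h₂ => simp [encodePattern, List.foldlM_append, parseStep, h₁, h₂]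
  | filter P C h => simp [encodePattern, List.foldlM_append, h, parse_encodeConstraint]

/-- The string encoding of patterns. -/
def patternEncoding : Computability.Encoding BPattern Sym where
  encode := encodePattern
  decode := decodePattern
  decode_encode P := by simp [decodePattern, parse_encodePattern]

/-- The satisfiability problem for the fragment `SPARQL(F)`, as a formal language: the codes of
the satisfiable patterns of the fragment. -/
def satLanguage (B : Type*) (F : Set ConstraintClass) : Language Sym :=
  {s | ∃ P : BPattern, patternEncoding.encode P = s ∧ P.InFragment F ∧ Satisfiable B P}

end SPARQL

/-- The complexity class NP: a language `A` over a finite alphabet is in NP if it has a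
deterministic polynomial-time (Turing machine) verifier `R` and a polynomial `q` such that `x`
is in `A` iff `R` accepts `(x, w)` for some certificate `w` of length at most `q(|x|)`. -/
def InNP {Γ : Type} [Fintype Γ] (A : Language Γ) : Prop :=
  ∃ (R : List Γ × List Bool → Bool) (q : Polynomial ℕ),
    Nonempty (Turing.TM2ComputableInPolyTime
      (Computability.encodingProd (Computability.encodingList Γ)
        (Computability.encodingList Bool)).encode
      Computability.encodeBool R) ∧
    ∀ x : List Γ, x ∈ A ↔ ∃ w : List Bool, w.length ≤ q.eval x.length ∧ R (x, w) = true

/-!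
Filter conditions of the two fragments never demand that a variable be unbound. So whether a pattern
is satisfiable depends only on which domains its solutions can have: call a list of variables a
scheme of the pattern if it is such a domain, when filter conditions are only required to have their
variables bound (`Pattern.HasScheme`). The domain of every solution is a scheme
(`exists_hasScheme`). Conversely, fix a value for each variable, an IRI at least as long as the code
of the pattern: the same one for all variables in the presence of equalities, pairwise different ones in
the presence of nonequalities. Under these canonical values every condition with bound variables
holds, because the constants of the conditions `≠_c` are shorter than the values. All canonical
mappings are compatible with each other, so on the graph consisting of the images of all triple
patterns, `AND` and `OPT` only ever enlarge domains, and a pattern with a scheme has a canonical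
solution (`exists_canonicalMapping_mem_sem`). Hence a pattern of the fragments is satisfiable if and
only if it has a scheme (`satisfiable_iff_exists_hasScheme`).

To find a scheme, it is enough to guess which triple patterns take part in it, and to evaluate the
postfix code of the pattern on a stack of schemes. This is done by a nondeterministic program whose
elementary actions push, pop, and test for emptiness on finitely many stacks, and whose control is a
regular set of sequences of actions, built from single actions by sum, product, and iteration. For
such programs, membership in NP is proved once and for all (`StackProgram.inNP_of_program`): a
certificate is the sequence of actions of an accepting execution, and a machine replays it in linear
time, while a finite automaton checks that the sequence belongs to the regular set. The automaton
exists since the regular languages are closed under the operations used, because they are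
the languages with finitely many left quotients (`Language.IsRegular.mul`,
`Language.IsRegular.kstar`).

It remains to see that the program is sound, i.e. that every accepted word is the code of a pattern
of the fragment with a scheme (`exists_of_exec_program`), and that it is complete, with executions of
quadratic length (`runs_program`).
-/

/-! ### Closure properties of regular languages -/

namespace Language

variable {α : Type*}

theorem isRegular_singleton (w : List α) : ({w} : Language α).IsRegular := by
  rw [isRegular_iff_finite_range_leftQuotient]
  have hfin : ({v | v <:+ w} : Set (List α)).Finite :=
    (w.tails.finite_toSet).subset fun v hv => by simpa using hv
  refine ((hfin.image fun v => ({v} : Language α)).union (Set.finite_singleton 0)).subset ?_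
  rintro _ ⟨u, rfl⟩
  by_cases h : ∃ v, u ++ v = w
  · obtain ⟨v, rfl⟩ := h
    refine Or.inl ⟨v, List.suffix_append _ _, ?_⟩
    ext y
    change y = v ↔ u ++ y = u ++ v
    simp
  · refine Or.inr ?_
    change leftQuotient _ _ = 0
    ext y
    exact ⟨fun hy => h ⟨y, hy⟩, fun hy => absurd hy (notMem_zero y)⟩

theorem isRegular_zero : (0 : Language α).IsRegular := by
  rw [isRegular_iff_finite_range_leftQuotient]
  refine (Set.finite_singleton 0).subset ?_
  rintro _ ⟨u, rfl⟩
  rfl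

theorem isRegular_one : (1 : Language α).IsRegular :=
  isRegular_singleton []

theorem isRegular_sum {ι : Type*} (s : Finset ι) (L : ι → Language α)
    (h : ∀ i, (L i).IsRegular) : (∑ i ∈ s, L i).IsRegular := by
  classical
  induction s using Finset.induction_on with
  | empty => simpa using isRegular_zero
  | insert i s hi ih => rw [Finset.sum_insert hi]; exact (h i).add ih

/-- The left quotients of `L * M` are sums of one left quotient of `L`, multiplied by `M`, and of
left quotients of `M`. -/
theorem IsRegular.mul {L M : Language α} (hL : L.IsRegular) (hM : M.IsRegular) :
    (L * M).IsRegular := by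
  rw [isRegular_iff_finite_range_leftQuotient] at *
  refine ((hL.prod hM.powerset).image
    fun p : Language α × Set (Language α) => p.1 * M + (⨆ N ∈ p.2, N)).subset ?_
  rintro _ ⟨w, rfl⟩
  refine ⟨(L.leftQuotient w, {N | ∃ u v, u ∈ L ∧ u ++ v = w ∧ M.leftQuotient v = N}),
    ⟨⟨w, rfl⟩, ?_⟩, ?_⟩
  · rintro _ ⟨u, v, -, -, rfl⟩
    exact ⟨v, rfl⟩
  · ext y
    simp only [mem_add, mem_mul, mem_leftQuotient, mem_iSup, Set.mem_ofPred_eq, exists_prop]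
    constructor
    · rintro (⟨a, ha, b, hb, rfl⟩ | ⟨_, ⟨u, v, hu, rfl, rfl⟩, hy⟩)
      · exact ⟨w ++ a, ha, b, hb, by simp⟩
      · exact ⟨u, hu, v ++ y, hy, by simp⟩
    · rintro ⟨a, ha, b, hb, hab⟩
      obtain ⟨c, rfl, rfl⟩ | ⟨c, rfl, rfl⟩ := List.append_eq_append_iff.1 hab
      · exact Or.inr ⟨_, ⟨a, c, ha, rfl, rfl⟩, hb⟩
      · exact Or.inl ⟨c, ha, b, hb, rfl⟩

/-- The left quotients of `L∗`, other than `L∗` itself, are sums of left quotients of `L`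
multiplied by `L∗`. -/
theorem IsRegular.kstar {L : Language α} (hL : L.IsRegular) : (KStar.kstar L).IsRegular := by
  rw [isRegular_iff_finite_range_leftQuotient] at *
  refine ((hL.powerset.image
    fun p : Set (Language α) => (⨆ N ∈ p, N * KStar.kstar L)).union
      (Set.finite_singleton (KStar.kstar L))).subset ?_
  rintro _ ⟨w, rfl⟩
  by_cases hw : w = []
  · exact Or.inr (by simp [hw])
  refine Or.inl ⟨{N | ∃ u v, u ∈ KStar.kstar L ∧ u ++ v = w ∧ L.leftQuotient v = N}, ?_, ?_⟩
  · rintro _ ⟨u, v, -, -, rfl⟩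
    exact ⟨v, rfl⟩
  ext y
  simp only [mem_leftQuotient, mem_iSup, Set.mem_ofPred_eq, exists_prop, mem_mul]
  constructor
  · rintro ⟨_, ⟨u, v, hu, rfl, rfl⟩, a, ha, b, hb, rfl⟩
    obtain ⟨l₁, rfl, h₁⟩ := mem_kstar.1 hu
    obtain ⟨l₂, rfl, h₂⟩ := mem_kstar.1 hb
    refine mem_kstar.2 ⟨l₁ ++ [v ++ a] ++ l₂, by simp, ?_⟩
    intro z hz
    simp only [List.mem_append, List.mem_singleton] at hz
    rcases hz with (hz | rfl) | hz
    exacts [h₁ _ hz, ha, h₂ _ hz]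
  · intro h
    obtain ⟨l, hl, h'⟩ := mem_kstar.1 h
    -- the block of the factorization in which `w` ends
    suffices H : ∀ (l : List (List α)) (w : List α), w ≠ [] → w ++ y = l.flatten →
        (∀ z ∈ l, z ∈ L) → ∃ u v, u ∈ KStar.kstar L ∧ u ++ v = w ∧
          ∃ a, v ++ a ∈ L ∧ ∃ b ∈ KStar.kstar L, a ++ b = y by
      obtain ⟨u, v, hu, huv, a, ha, b, hb, hab⟩ := H l w hw hl h'
      exact ⟨_, ⟨u, v, hu, huv, rfl⟩, a, ha, b, hb, hab⟩
    clear hl h' h hw w l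
    intro l
    induction l with
    | nil => intro w hw hl; simp [hw] at hl
    | cons z l ih =>
      intro w hw hl h'
      rw [List.flatten_cons] at hl
      obtain ⟨c, rfl, hc⟩ | ⟨c, rfl, hc⟩ := List.append_eq_append_iff.1 hl
      · exact ⟨[], w, nil_mem_kstar _, rfl, c, h' _ (by simp), _,
          join_mem_kstar fun x hx => h' x (by simp [hx]), hc.symm⟩
      · by_cases hc0 : c = []
        · subst hc0
          exact ⟨[], z, nil_mem_kstar _, by simp, [], by simpa using h' z (by simp), y,
            by
              rw [List.nil_append] at hc
              rw [← hc]
              exact join_mem_kstar fun x hx => h' x (by simp [hx]), rfl⟩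
        · obtain ⟨u, v, hu, rfl, hrest⟩ := ih c hc0 hc.symm fun x hx => h' x (by simp [hx])
          refine ⟨z ++ u, v, ?_, by simp, hrest⟩
          obtain ⟨l₁, rfl, h₁⟩ := mem_kstar.1 hu
          refine mem_kstar.2 ⟨z :: l₁, by simp, ?_⟩
          intro x hx
          rcases List.mem_cons.1 hx with rfl | hx
          exacts [h' _ (by simp), h₁ _ hx]

end Language

/-! ### Nondeterministic stack programs -/

namespace StackProgram

/-- An elementary action on `m` stacks. -/
inductive Act (m : ℕ) (Γ : Type)
  | push (k : Fin m) (a : Γ)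
  | pop (k : Fin m) (a : Γ)
  | empty (k : Fin m)
  deriving Fintype

variable {m : ℕ} {Γ : Type}

open Classical in
/-- The effect of an action: `push k a` pushes `a` on stack `k`, `pop k a` succeeds if `a` is
on top of stack `k` and removes it, `empty k` succeeds if stack `k` is empty. -/
noncomputable def Act.exec (s : Fin m → List Γ) : Act m Γ → Option (Fin m → List Γ)
  | .push k a => some (Function.update s k (a :: s k))
  | .pop k a => if (s k).head? = some a then some (Function.update s k (s k).tail) else none
  | .empty k => if s k = [] then some s else none

/-- The effect of a sequence of actions, `none` if one of them fails. -/
noncomputable def execList (s : Fin m → List Γ) : List (Act m Γ) → Option (Fin m → List Γ)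
  | [] => some s
  | a :: l => (a.exec s).bind fun s' => execList s' l

/-- The initial store of a program: the input, written backwards, is on stack `0`. -/
def initStore (x : List Γ) : Fin (m + 1) → List Γ :=
  fun k => if k = 0 then x.reverse else []

/-- The stacks of the verifying machine: the input tape, the output tape, and the stacks of the
simulated program. -/
inductive Tape (m : ℕ)
  | inp
  | out
  | work (k : Fin m)
  deriving DecidableEq, Fintype

/-- The labels of the verifying machine. In phase `run q c`, the machine simulates a program given
by a finite automaton, whose current state is `q`; the number of bits `true` read since the last
bit `false` is `c`, taken modulo the number of actions. -/
inductive Label (m n : ℕ) (Γ Q : Type)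
  | load
  | store (a : Γ)
  | run (q : Q) (c : Fin (n + 1))
  | drain (b : Bool)
  | clean (b : Bool) (i : Fin (m + 1))
  deriving Fintype

variable {n : ℕ} {Q : Type}

/-- The alphabets of the stacks of the verifying machine. -/
abbrev TapeAlphabet (m : ℕ) (Γ : Type) : Tape m → Type
  | .inp => Γ ⊕ Bool
  | .out => Bool
  | .work _ => Γ

/-- Contents of the stacks of the verifying machine. -/
def tapes (i : List (Γ ⊕ Bool)) (o : List Bool) (s : Fin m → List Γ) :
    (k : Tape m) → List (TapeAlphabet m Γ k)
  | .inp => i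
  | .out => o
  | .work k => s k

theorem update_tapes_inp (i i' : List (Γ ⊕ Bool)) (o : List Bool) (s : Fin m → List Γ) :
    Function.update (tapes i o s) .inp i' = tapes i' o s := by
  funext k
  cases k <;> simp [tapes]

theorem update_tapes_out (i : List (Γ ⊕ Bool)) (o o' : List Bool) (s : Fin m → List Γ) :
    Function.update (tapes i o s) .out o' = tapes i o' s := by
  funext k
  cases k <;> simp [tapes]

theorem update_tapes_work (i : List (Γ ⊕ Bool)) (o : List Bool) (s : Fin m → List Γ)
    (k : Fin m) (l : List Γ) :
    Function.update (tapes i o s) (.work k) l = tapes i o (Function.update s k l) := by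
  funext j
  cases j with
  | work j =>
    by_cases h : j = k
    · subst h; simp [tapes]
    · simp [tapes, h]
  | inp => simp [tapes]
  | out => simp [tapes]

section Machine

open Turing.TM2.Stmt

variable (d : Fin (n + 1) → Act (m + 1) Γ) (D : DFA (Act (m + 1) Γ) Q)

/-- The register of the verifying machine, holding the symbol last read. -/
abbrev Register (Γ : Type) : Type := Option (Γ ⊕ Bool)

/-- The statements of the verifying machine. -/
abbrev MStmt (m n : ℕ) (Γ Q : Type) : Type :=
  Turing.TM2.Stmt (TapeAlphabet m Γ) (Label m n Γ Q) (Register Γ)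

/-- Empty the register, then jump. -/
def jump (l : Label m n Γ Q) : MStmt m n Γ Q :=
  load (fun _ => none) <| goto fun _ => l

open Classical in
/-- Perform an action, and jump to one of two labels according to its success. -/
noncomputable def actStmt (l l' : Label m n Γ Q) : Act m Γ → MStmt m n Γ Q
  | .push k a => push (.work k) (fun _ => a) <| jump l
  | .pop k a => pop (.work k) (fun _ o => o.map .inl) <|
      branch (fun v => decide (v = some (.inl a))) (jump l) (jump l')
  | .empty k => peek (.work k) (fun _ o => o.map .inl) <|
      branch Option.isNone (jump l) (jump l')

open Classical in
/-- The program of the verifying machine. The input is a word followed by a bit string. The word is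
moved to stack `0`. The bit string is read as a sequence of actions, action number `c` being written
as `c` bits `true` followed by a bit `false`; the machine performs these actions, and verifies that
the automaton accepts their sequence. -/
noncomputable def machine : Label (m + 1) n Γ Q → MStmt (m + 1) n Γ Q
  | .load => peek .inp (fun _ o => o) <|
      branch (fun v => (v.bind Sum.getLeft?).isSome)
        (pop .inp (fun _ o => o) <| goto fun
          | some (.inl a) => .store a
          | _ => .load)
        (jump (.run D.start 0))
  | .store a => push (.work 0) (fun _ => a) <| jump .load
  | .run q c => pop .inp (fun _ o => o) <|
      branch (fun v => decide (v = some (.inr true))) (jump (.run q (c + 1))) <|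
      branch (fun v => decide (v = some (.inr false)))
        (actStmt (.run (D.step q (d c)) 0) (.drain false) (d c)) <|
      jump (.drain (decide (q ∈ D.accept)))
  | .drain b => pop .inp (fun _ o => o) <|
      branch Option.isSome (jump (.drain b)) (jump (.clean b 0))
  | .clean b i => if h : (i : ℕ) < m + 1 then
      pop (.work ⟨i, h⟩) (fun _ o => o.map .inl) <|
        branch Option.isSome (jump (.clean b i)) (jump (.clean b (i + 1)))
      else push .out (fun _ => b) halt

/-- Configurations of the verifying machine. -/
abbrev MCfg (m n : ℕ) (Γ Q : Type) : Type :=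
  Turing.TM2.Cfg (TapeAlphabet m Γ) (Label m n Γ Q) (Register Γ)

/-- The machine, started in `c`, halts within `t` steps, with output `b`, and with its other
stacks and its register empty. -/
def HaltsWith (b : Bool) (c : MCfg (m + 1) n Γ Q) (t : ℕ) : Prop :=
  ∃ k ≤ t, (flip bind (Turing.TM2.step (machine d D)))^[k] (some c) =
    some ⟨none, none, tapes [] [b] fun _ => []⟩

variable {d D}

theorem HaltsWith.mono {b : Bool} {c : MCfg (m + 1) n Γ Q} {t t' : ℕ} (h : HaltsWith d D b c t)
    (htt : t ≤ t') : HaltsWith d D b c t' := by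
  obtain ⟨k, hk, h⟩ := h
  exact ⟨k, hk.trans htt, h⟩

theorem HaltsWith.step {b : Bool} {l : Label (m + 1) n Γ Q} {v : Register Γ}
    {S : (k : Tape (m + 1)) → List (TapeAlphabet (m + 1) Γ k)} {t : ℕ}
    (h : HaltsWith d D b (Turing.TM2.stepAux (machine d D l) v S) t) :
    HaltsWith d D b ⟨some l, v, S⟩ (t + 1) := by
  obtain ⟨k, hk, h⟩ := h
  exact ⟨k + 1, by omega, by rw [Function.iterate_succ_apply]; exact h⟩

/-- The total height of the stacks. -/
def height (s : Fin m → List Γ) : ℕ := ∑ k, (s k).length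

theorem height_update (s : Fin m → List Γ) (k : Fin m) (l : List Γ) :
    height (Function.update s k l) + (s k).length = height s + l.length := by
  unfold height
  rw [← Finset.add_sum_erase _ _ (Finset.mem_univ k),
    ← Finset.add_sum_erase Finset.univ (fun k => (s k).length) (Finset.mem_univ k),
    Finset.sum_congr rfl fun j hj => by
      rw [Function.update_of_ne (Finset.ne_of_mem_erase hj)], Function.update_self]
  omega

/-- In label `clean b i`, only the stacks with numbers from `i` on are possibly not empty. -/
theorem haltsWith_clean (b : Bool) (j : ℕ) : ∀ (i : Fin (m + 2)) (s : Fin (m + 1) → List Γ),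
    (i : ℕ) + j = m + 1 → (∀ k : Fin (m + 1), (k : ℕ) < i → s k = []) →
    HaltsWith d D b ⟨some (.clean b i), none, tapes [] [] s⟩ (height s + j + 1) := by
  induction j with
  | zero =>
    intro i s hi hs
    have hs' : s = fun _ => [] := funext fun k => hs k (by omega)
    refine HaltsWith.step ⟨0, by omega, ?_⟩
    have : ¬ (i : ℕ) < m + 1 := by omega
    simp only [machine, this, dite_false, Function.iterate_zero, id, Turing.TM2.stepAux,
      update_tapes_out]
    rw [hs']
    rfl
  | succ j ih =>
    intro i s hi
    have hi' : (i : ℕ) < m + 1 := by omega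
    generalize hl : s ⟨i, hi'⟩ = l
    induction l generalizing s with
    | nil =>
      intro hs
      refine (HaltsWith.step (t := height s + j + 1) ?_).mono (by omega)
      have h0 : tapes ([] : List (Γ ⊕ Bool)) [] s (.work ⟨i, hi'⟩) = [] := hl
      simp only [machine, hi', dite_true, Turing.TM2.stepAux, jump, h0, List.head?_nil,
        Option.map_none, Option.isSome_none, cond_false, List.tail_nil, update_tapes_work]
      rw [← hl, Function.update_eq_self]
      have hv : ((i + 1 : Fin (m + 2)) : ℕ) = i + 1 :=
        Fin.val_add_one_of_lt (by rw [Fin.lt_def]; simpa using hi')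
      refine ih _ _ (by omega) fun k hk => ?_
      by_cases hki : (k : ℕ) = i
      · have : k = ⟨i, hi'⟩ := Fin.ext hki
        rw [this, hl]
      · exact hs k (by omega)
    | cons a l ihl =>
      intro hs
      have hh := height_update s ⟨i, hi'⟩ l
      rw [hl, List.length_cons] at hh
      refine (HaltsWith.step (t := height (Function.update s ⟨i, hi'⟩ l) + (j + 1) + 1)
        ?_).mono (by omega)
      have h0 : tapes ([] : List (Γ ⊕ Bool)) [] s (.work ⟨i, hi'⟩) = a :: l := hl
      simp only [machine, hi', dite_true, Turing.TM2.stepAux, jump, h0, List.head?_cons,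
        Option.map_some, Option.isSome_some, cond_true, List.tail_cons, update_tapes_work]
      refine ihl _ (Function.update_self ..) fun k hk => ?_
      rw [Function.update_of_ne (fun h => by subst h; exact absurd hk (lt_irrefl _))]
      exact hs k hk

theorem haltsWith_drain (b : Bool) (s : Fin (m + 1) → List Γ) (i : List (Γ ⊕ Bool)) :
    HaltsWith d D b ⟨some (.drain b), none, tapes i [] s⟩ (i.length + height s + m + 3) := by
  induction i with
  | nil =>
    refine (HaltsWith.step (t := height s + (m + 1) + 1) ?_).mono (by simp; omega)
    simp only [machine, Turing.TM2.stepAux, jump, tapes, List.head?_nil, Option.isSome_none,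
      cond_false, List.tail_nil]
    have h := haltsWith_clean (d := d) (D := D) b (m + 1) 0 s (by simp) (by simp)
    convert h using 2
    exact update_tapes_inp ..
  | cons a i ih =>
    refine (HaltsWith.step (t := i.length + height s + m + 3) ?_).mono (by simp)
    simp only [machine, Turing.TM2.stepAux, jump, tapes, List.head?_cons, Option.isSome_some,
      cond_true, List.tail_cons]
    convert ih using 2
    exact update_tapes_inp ..

variable (d D) in
open Classical in
/-- The verdict of the verifying machine in label `run q c`, as a function of the store and of
the rest of the bit string. -/
noncomputable def verdict : Q → Fin (n + 1) → (Fin (m + 1) → List Γ) → List Bool → Bool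
  | q, _, _, [] => decide (q ∈ D.accept)
  | q, c, s, true :: w => verdict q (c + 1) s w
  | q, c, s, false :: w =>
      match (d c).exec s with
      | none => false
      | some s' => verdict (D.step q (d c)) 0 s' w

/-- Performing an action takes one step. A failed `pop` still removes a symbol, which is harmless
because the store is erased after a failure. -/
theorem stepAux_actStmt (l l' : Label m n Γ Q) (a : Act m Γ) (v : Register Γ)
    (i : List (Γ ⊕ Bool)) (o : List Bool) (s : Fin m → List Γ) :
    ∃ s', height s' ≤ height s + 1 ∧ (∀ s₁, a.exec s = some s₁ → s' = s₁) ∧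
      Turing.TM2.stepAux (actStmt l l' a) v (tapes i o s) =
        ⟨some (if (a.exec s).isSome then l else l'), none, tapes i o s'⟩ := by
  cases a with
  | push k a =>
    have := height_update s k (a :: s k)
    refine ⟨Function.update s k (a :: s k), by simp at this; omega, by simp [Act.exec], ?_⟩
    simp [actStmt, jump, Act.exec, tapes, update_tapes_work]
  | pop k a =>
    have := height_update s k (s k).tail
    refine ⟨Function.update s k (s k).tail, by simp at this; omega, by simp [Act.exec], ?_⟩
    by_cases h : (s k).head? = some a
    · simp [actStmt, jump, Act.exec, tapes, update_tapes_work, h]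
    · simp [actStmt, jump, Act.exec, tapes, update_tapes_work, h]
  | empty k =>
    refine ⟨s, by omega, by simp [Act.exec], ?_⟩
    by_cases h : s k = []
    · simp [actStmt, jump, Act.exec, tapes, h]
    · obtain ⟨b, l, hl⟩ := List.exists_cons_of_ne_nil h
      simp [actStmt, jump, Act.exec, tapes, hl]

theorem haltsWith_run (w : List Bool) (q : Q) (c : Fin (n + 1)) (s : Fin (m + 1) → List Γ) :
    HaltsWith d D (verdict d D q c s w) ⟨some (.run q c), none, tapes (w.map .inr) [] s⟩
      (2 * w.length + height s + m + 4) := by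
  classical
  induction w generalizing q c s with
  | nil =>
    refine (HaltsWith.step (t := height s + m + 3) ?_).mono (by simp)
    simp only [machine, Turing.TM2.stepAux, jump, tapes, List.map_nil, List.head?_nil,
      List.tail_nil, reduceCtorEq, decide_false, cond_false, verdict]
    have h := haltsWith_drain (d := d) (D := D) (decide (q ∈ D.accept)) s []
    rw [List.length_nil, Nat.zero_add] at h
    convert h using 2
    exact update_tapes_inp ..
  | cons b w ih =>
    cases b with
    | true =>
      refine (HaltsWith.step (t := 2 * w.length + height s + m + 4) ?_).mono (by simp)
      simp only [machine, Turing.TM2.stepAux, jump, tapes, List.map_cons, List.head?_cons,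
        List.tail_cons, decide_true, cond_true, verdict]
      convert ih q (c + 1) s using 2
      exact update_tapes_inp ..
    | false =>
      refine (HaltsWith.step (t := 2 * w.length + height s + m + 5) ?_).mono (by simp; omega)
      simp only [machine, Turing.TM2.stepAux, tapes, List.map_cons, List.head?_cons,
        List.tail_cons, Option.some.injEq, Sum.inr.injEq, Bool.false_eq_true, decide_false,
        cond_false, decide_true, cond_true, verdict]
      rw [show Function.update (tapes (Sum.inr false :: w.map .inr) [] s) .inp
        (w.map .inr) = tapes (w.map .inr) [] s from update_tapes_inp ..]
      obtain ⟨s', hs', hex, hst⟩ := stepAux_actStmt (n := n) (Q := Q) (.run (D.step q (d c)) 0)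
        (.drain false) (d c) (some (.inr false)) (w.map .inr) [] s
      rw [hst]
      cases he : (d c).exec s with
      | none =>
        exact (haltsWith_drain (d := d) (D := D) false s' (w.map .inr)).mono (by simp; omega)
      | some s₁ =>
        rw [hex s₁ he] at hs' ⊢
        exact (ih (D.step q (d c)) 0 s₁).mono (by omega)

theorem haltsWith_load (x : List Γ) (w : List Bool) (s : Fin (m + 1) → List Γ) :
    HaltsWith d D (verdict d D D.start 0 (Function.update s 0 (x.reverse ++ s 0)) w)
      ⟨some .load, none, tapes (x.map .inl ++ w.map .inr) [] s⟩
      (3 * x.length + 2 * w.length + height s + m + 5) := by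
  induction x generalizing s with
  | nil =>
    refine (HaltsWith.step (t := 2 * w.length + height s + m + 4) ?_).mono (by simp)
    have h : (((w.map (.inr : Bool → Γ ⊕ Bool)).head?).bind Sum.getLeft?).isSome = false := by
      cases w <;> rfl
    simp only [machine, Turing.TM2.stepAux, jump, tapes, List.map_nil, List.nil_append, h,
      cond_false, List.reverse_nil, Function.update_eq_self]
    exact haltsWith_run w D.start 0 s
  | cons a x ih =>
    have hh := height_update s 0 (a :: s 0)
    rw [List.length_cons] at hh
    refine (HaltsWith.step (HaltsWith.step
      (t := 3 * x.length + 2 * w.length + (height s + 1) + m + 5) ?_)).mono (by simp; omega)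
    simp only [machine, Turing.TM2.stepAux, jump, tapes, List.map_cons, List.cons_append,
      List.head?_cons, List.tail_cons]
    rw [show Function.update (tapes (Sum.inl a :: (x.map .inl ++ w.map .inr)) [] s) .inp
        (x.map .inl ++ w.map .inr) = tapes (x.map .inl ++ w.map .inr) [] s from
          update_tapes_inp .., update_tapes_work]
    have := ih (Function.update s 0 (a :: s 0))
    simp only [Function.update_self, Function.update_idem] at this
    have := this.mono
      (by omega : _ ≤ 3 * x.length + 2 * w.length + (height s + 1) + m + 5)
    rw [List.reverse_cons, List.append_assoc, List.singleton_append]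
    exact this

end Machine

/-- The code of a sequence of actions as a bit string, for a numbering `e` of the actions. -/
def encodeActs (e : Act m Γ → Fin (n + 1)) (l : List (Act m Γ)) : List Bool :=
  l.flatMap fun a => List.replicate (e a) true ++ [false]

theorem length_encodeActs_le (e : Act m Γ → Fin (n + 1)) (l : List (Act m Γ)) :
    (encodeActs e l).length ≤ (n + 1) * l.length := by
  induction l with
  | nil => simp [encodeActs]
  | cons a l ih =>
    simp only [encodeActs, List.flatMap_cons, List.length_append, List.length_replicate,
      List.length_cons, List.length_nil] at ih ⊢
    have := (e a).isLt
    rw [mul_add]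
    omega

theorem verdict_replicate (d : Fin (n + 1) → Act (m + 1) Γ) (D : DFA (Act (m + 1) Γ) Q) (q : Q)
    (j : ℕ) (c : Fin (n + 1)) (s : Fin (m + 1) → List Γ) (w : List Bool) :
    verdict d D q c s (List.replicate j true ++ w) = verdict d D q (c + Fin.ofNat (n + 1) j) s w := by
  induction j generalizing c with
  | zero => simp
  | succ j ih =>
    rw [List.replicate_succ, List.cons_append, verdict, ih]
    congr 1
    apply Fin.ext
    simp [Fin.val_add, Nat.add_assoc, Nat.add_comm 1 j]

theorem verdict_encodeActs (e : Act (m + 1) Γ ≃ Fin (n + 1)) (D : DFA (Act (m + 1) Γ) Q)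
    (l : List (Act (m + 1) Γ)) (q : Q) (s : Fin (m + 1) → List Γ) :
    verdict e.symm D q 0 s (encodeActs e l) = true ↔
      D.evalFrom q l ∈ D.accept ∧ (execList s l).isSome := by
  induction l generalizing q s with
  | nil => simp [encodeActs, verdict, execList]
  | cons a l ih =>
    simp only [encodeActs, List.flatMap_cons, List.append_assoc, List.singleton_append]
    rw [verdict_replicate, verdict]
    have : e.symm (0 + Fin.ofNat (n + 1) (e a)) = a := by simp
    rw [this, DFA.evalFrom_cons, execList]
    cases a.exec s with
    | none => simp
    | some s' => exact ih _ _

/-- Every accepted bit string describes a sequence of executable actions. -/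
theorem exists_acts_of_verdict (d : Fin (n + 1) → Act (m + 1) Γ) (D : DFA (Act (m + 1) Γ) Q)
    (w : List Bool) (q : Q) (c : Fin (n + 1)) (s : Fin (m + 1) → List Γ)
    (h : verdict d D q c s w = true) :
    ∃ l, D.evalFrom q l ∈ D.accept ∧ (execList s l).isSome := by
  induction w generalizing q c s with
  | nil => exact ⟨[], by simpa [verdict] using h, rfl⟩
  | cons b w ih =>
    cases b with
    | true => exact ih q (c + 1) s h
    | false =>
      rw [verdict] at h
      cases he : (d c).exec s with
      | none => simp [he] at h
      | some s' =>
        rw [he] at h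
        obtain ⟨l, hl, hl'⟩ := ih _ _ _ h
        exact ⟨d c :: l, by rwa [DFA.evalFrom_cons], by simpa [execList, he] using hl'⟩

/-- A language is in NP if it is the language of the words accepted by a nondeterministic stack
program, given as a regular set `L` of action sequences, and if the accepted words have
executions of polynomial length. A certificate is the sequence of actions of an execution. -/
theorem inNP_of_program [Fintype Γ] {L : Language (Act (m + 1) Γ)} (hL : L.IsRegular)
    (p : Polynomial ℕ) {A : Language Γ}
    (complete : ∀ x ∈ A, ∃ l ∈ L, l.length ≤ p.eval x.length ∧ (execList (initStore x) l).isSome)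
    (sound : ∀ x, ∀ l ∈ L, (execList (initStore x) l).isSome → x ∈ A) : InNP A := by
  classical
  obtain ⟨Q, _, D, rfl⟩ := hL
  obtain ⟨n, hn⟩ : ∃ n, Fintype.card (Act (m + 1) Γ) = n + 1 :=
    Nat.exists_eq_succ_of_ne_zero (@Fintype.card_ne_zero _ _ ⟨.empty 0⟩)
  let e : Act (m + 1) Γ ≃ Fin (n + 1) := Fintype.equivFinOfCardEq hn
  refine ⟨fun y => verdict e.symm D D.start 0 (initStore y.1) y.2, Polynomial.C (n + 1) * p,
    ⟨?_⟩, fun x => ⟨fun hx => ?_, ?_⟩⟩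
  · refine
      { tm :=
          { K := Tape (m + 1)
            k₀ := .inp
            k₁ := .out
            Γ := TapeAlphabet (m + 1) Γ
            Λ := Label (m + 1) n Γ Q
            main := .load
            σ := Register Γ
            initialState := none
            Γk₀Fin := inferInstanceAs (Fintype (Γ ⊕ Bool))
            m := machine e.symm D }
        inputAlphabet := Equiv.refl _
        outputAlphabet := Equiv.refl _
        time := Polynomial.C 3 * Polynomial.X + Polynomial.C (m + 5)
        outputsFun := fun y => ?_ }
    obtain ⟨x, w⟩ := y
    have h := haltsWith_load (d := e.symm) (D := D) x w fun _ => []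
    have h0 : Function.update (fun _ => []) 0 (x.reverse ++ []) =
        (initStore x : Fin (m + 1) → List Γ) := by
      funext k
      by_cases hk : k = 0
      · subst hk; simp [initStore]
      · simp [initStore, hk]
    rw [h0] at h
    choose k hk hsteps using h
    refine ⟨⟨k, ?_⟩, ?_⟩
    · refine Eq.trans ?_ (hsteps.trans ?_)
      · congr 2
        simp only [Turing.initList]
        congr 1
        funext j
        cases j <;> simp [tapes, Computability.encodingProd, Computability.encodingList]
      · simp only [Option.map_some, Turing.haltList]
        congr 2
        funext j
        cases j <;> simp [tapes, Computability.encodeBool]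
    · refine hk.trans ?_
      simp [Computability.encodingProd, Computability.encodingList, height]
      omega
  · obtain ⟨l, hl, hlen, hex⟩ := complete x hx
    refine ⟨encodeActs e l, (length_encodeActs_le _ _).trans ?_, ?_⟩
    · rw [Polynomial.eval_mul, Polynomial.eval_C]
      exact Nat.mul_le_mul_left _ hlen
    · exact (verdict_encodeActs e D l D.start _).2 ⟨hl, hex⟩
  · rintro ⟨w, -, hw⟩
    obtain ⟨l, hl, hex⟩ := exists_acts_of_verdict _ _ _ _ _ _ hw
    exact sound x l hl hex

end StackProgram

/-! ### Schemes of patterns -/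

namespace SPARQL

/-- The variables of an element of `I ∪ L ∪ V`, as a list. -/
def PTerm.varList {I L V : Type*} : PTerm I L V → List V
  | .iri _ => []
  | .lit _ => []
  | .var x => [x]

/-- The variables of a constraint, as a list. -/
def Constraint.varList {I L V : Type*} : Constraint I L V → List V
  | .bound x => [x]
  | .notBound x => [x]
  | .eq x y => [x, y]
  | .ne x y _ => [x, y]
  | .eqConst x _ => [x]
  | .neConst x _ => [x]

/-- `P.HasScheme S` says that `S` lists a possible domain of a solution of `P`, if each filter
condition is only required to have its variables bound. The order of the entries of `S`, and their
multiplicities, are those in which the variables are found on the stack of the program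
recognizing satisfiable patterns. -/
def Pattern.HasScheme {I L V : Type*} : Pattern I L V → List V → Prop
  | .triple u v w, S => (∀ l, u ≠ .lit l) ∧
      S = w.varList ++ ((v.toPTerm : PTerm I L V).varList ++ u.varList)
  | .union P₁ P₂, S => P₁.HasScheme S ∨ P₂.HasScheme S
  | .and P₁ P₂, S => ∃ S₁ S₂, P₁.HasScheme S₁ ∧ P₂.HasScheme S₂ ∧ S = S₂ ++ S₁
  | .opt P₁ P₂, S => P₁.HasScheme S ∨
      ∃ S₁ S₂, P₁.HasScheme S₁ ∧ P₂.HasScheme S₂ ∧ S = S₂ ++ S₁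
  | .filter P C, S => P.HasScheme S ∧ ∀ x ∈ C.varList, x ∈ S

section Semantics

variable {I B L V : Type*}

theorem PTerm.mem_vars (t : PTerm I L V) (x : V) : x ∈ t.vars ↔ x ∈ t.varList := by
  cases t <;> simp [PTerm.vars, PTerm.varList]

theorem Mapping.dom_union (μ₁ μ₂ : Mapping I B L V) : (μ₁.union μ₂).dom = μ₁.dom ∪ μ₂.dom := by
  ext x
  simp only [Mapping.dom, Mapping.union, Set.mem_union, Set.mem_ofPred_eq]
  cases μ₁.toFun x <;> simp

theorem Mapping.mem_dom_of_satisfies {μ : Mapping I B L V} {C : Constraint I L V}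
    (h : μ.Satisfies C) (hC : C.cls ≠ .notBound) : ∀ x ∈ C.varList, x ∈ μ.dom := by
  cases C <;> simp_all [Mapping.Satisfies, Constraint.varList, Constraint.cls]

/-- The domain of a solution mapping is a scheme. -/
theorem exists_hasScheme {F : Set ConstraintClass} (hF : .notBound ∉ F) {G : RDFGraph I B L}
    {P : Pattern I L V} (hP : P.InFragment F) {μ : Mapping I B L V} (hμ : μ ∈ sem G P) :
    ∃ S, P.HasScheme S ∧ ∀ x, x ∈ S ↔ x ∈ μ.dom := by
  induction P generalizing μ with
  | triple u v w =>
    obtain ⟨hdom, s, p, o, hs, -, -, hG⟩ := hμ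
    refine ⟨_, ⟨fun l hl => ?_, rfl⟩, fun x => ?_⟩
    · subst hl
      exact (G.isRDFTriple _ hG).1 l (Option.some_injective _ hs).symm
    · rw [hdom]
      simp only [List.mem_append, Set.mem_union, PTerm.mem_vars]
      tauto
  | union P₁ P₂ h₁ h₂ =>
    rcases hμ with hμ | hμ
    · obtain ⟨S, hS, h⟩ := h₁ hP.1 hμ
      exact ⟨S, Or.inl hS, h⟩
    · obtain ⟨S, hS, h⟩ := h₂ hP.2 hμ
      exact ⟨S, Or.inr hS, h⟩
  | and P₁ P₂ h₁ h₂ =>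
    obtain ⟨μ₁, hμ₁, μ₂, hμ₂, -, rfl⟩ := hμ
    obtain ⟨S₁, hS₁, h₁⟩ := h₁ hP.1 hμ₁
    obtain ⟨S₂, hS₂, h₂⟩ := h₂ hP.2 hμ₂
    refine ⟨_, ⟨S₁, S₂, hS₁, hS₂, rfl⟩, fun x => ?_⟩
    rw [Mapping.dom_union, List.mem_append, h₁, h₂, Set.mem_union, or_comm]
  | opt P₁ P₂ h₁ h₂ =>
    rcases hμ with ⟨μ₁, hμ₁, μ₂, hμ₂, -, rfl⟩ | ⟨hμ, -⟩
    · obtain ⟨S₁, hS₁, h₁⟩ := h₁ hP.1 hμ₁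
      obtain ⟨S₂, hS₂, h₂⟩ := h₂ hP.2 hμ₂
      refine ⟨_, Or.inr ⟨S₁, S₂, hS₁, hS₂, rfl⟩, fun x => ?_⟩
      rw [Mapping.dom_union, List.mem_append, h₁, h₂, Set.mem_union, or_comm]
    · obtain ⟨S, hS, h⟩ := h₁ hP.1 hμ
      exact ⟨S, Or.inl hS, h⟩
  | filter P C h =>
    obtain ⟨S, hS, hd⟩ := h hP.1 hμ.1
    refine ⟨S, ⟨hS, fun x hx => (hd x).2 ?_⟩, hd⟩
    exact Mapping.mem_dom_of_satisfies hμ.2 (fun h => hF (h ▸ hP.2)) x hx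

open Classical in
/-- The mapping with the domain listed by `D` that maps each variable `x` to the IRI `v x`. -/
noncomputable def canonicalMapping (B : Type*) (v : V → I) (D : List V) : Mapping I B L V where
  toFun x := if x ∈ D then some (.iri (v x)) else none
  finite_dom := D.finite_toSet.subset fun x hx => by
    by_contra h
    exact hx (if_neg h)

theorem mem_dom_canonicalMapping (v : V → I) (D : List V) (x : V) :
    x ∈ (canonicalMapping B v D : Mapping I B L V).dom ↔ x ∈ D := by
  simp [Mapping.dom, canonicalMapping]

theorem canonicalMapping_apply (v : V → I) {D : List V} {x : V} (hx : x ∈ D) :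
    (canonicalMapping B v D : Mapping I B L V).toFun x = some (.iri (v x)) :=
  if_pos hx

theorem canonicalMapping_compatible (v : V → I) (D₁ D₂ : List V) :
    (canonicalMapping B v D₁ : Mapping I B L V).Compatible (canonicalMapping B v D₂) := by
  intro x h₁ h₂
  rw [mem_dom_canonicalMapping] at h₁ h₂
  rw [canonicalMapping_apply v h₁, canonicalMapping_apply v h₂]

theorem canonicalMapping_union (v : V → I) (D₁ D₂ : List V) :
    (canonicalMapping B v D₁ : Mapping I B L V).union (canonicalMapping B v D₂) =
      canonicalMapping B v (D₂ ++ D₁) := by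
  ext1
  funext x
  by_cases h₁ : x ∈ D₁ <;> by_cases h₂ : x ∈ D₂ <;>
    simp [Mapping.union, canonicalMapping, h₁, h₂]

/-- The image of an element of `I ∪ L ∪ V` under the total mapping `v`. -/
def PTerm.value (B : Type*) (v : V → I) : PTerm I L V → RDFTerm I B L
  | .iri i => .iri i
  | .lit l => .lit l
  | .var x => .iri (v x)

theorem eval_canonicalMapping (v : V → I) {D : List V} {t : PTerm I L V}
    (h : ∀ x ∈ t.varList, x ∈ D) :
    (canonicalMapping B v D : Mapping I B L V).eval t = some (t.value B v) := by
  cases t with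
  | var x => exact canonicalMapping_apply v (h x (by simp [PTerm.varList]))
  | _ => rfl

/-- The images under `v` of the triple patterns in `P` whose subject is not a literal. -/
def Pattern.instances (B : Type*) (v : V → I) :
    Pattern I L V → Set (RDFTerm I B L × RDFTerm I B L × RDFTerm I B L)
  | .triple u p w => {t | (∀ l, u ≠ .lit l) ∧
      t = (u.value B v, (p.toPTerm : PTerm I L V).value B v, w.value B v)}
  | .union P₁ P₂ => P₁.instances B v ∪ P₂.instances B v
  | .and P₁ P₂ => P₁.instances B v ∪ P₂.instances B v
  | .opt P₁ P₂ => P₁.instances B v ∪ P₂.instances B v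
  | .filter P _ => P.instances B v

/-- The graph formed by the images under `v` of the triple patterns in `P`. -/
def canonicalGraph (B : Type*) (v : V → I) (P : Pattern I L V) : RDFGraph I B L where
  triples := P.instances B v
  finite_triples := by
    induction P with
    | triple u p w => exact (Set.finite_singleton _).subset fun t ht => ht.2
    | union P₁ P₂ h₁ h₂ => exact h₁.union h₂
    | and P₁ P₂ h₁ h₂ => exact h₁.union h₂
    | opt P₁ P₂ h₁ h₂ => exact h₁.union h₂
    | filter P C h => exact h
  isRDFTriple t ht := by
    induction P with
    | triple u p w =>
      obtain ⟨hu, rfl⟩ := ht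
      constructor
      · cases u <;> simp_all [PTerm.value]
      · cases p <;> simp [PTerm.value, PredTerm.toPTerm]
    | union P₁ P₂ h₁ h₂ => exact ht.elim h₁ h₂
    | and P₁ P₂ h₁ h₂ => exact ht.elim h₁ h₂
    | opt P₁ P₂ h₁ h₂ => exact ht.elim h₁ h₂
    | filter P C h => exact h ht

/-- Under the mappings with values given by `v`, the constraint `C` only demands that its
variables are bound. -/
def Constraint.Canonical (B : Type*) (v : V → I) (C : Constraint I L V) : Prop :=
  ∀ D : List V, (∀ x ∈ C.varList, x ∈ D) →
    (canonicalMapping B v D : Mapping I B L V).Satisfies C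

/-- All constraints of a pattern are canonical. -/
def Pattern.Canonical (B : Type*) (v : V → I) : Pattern I L V → Prop
  | .triple _ _ _ => True
  | .union P₁ P₂ => P₁.Canonical B v ∧ P₂.Canonical B v
  | .and P₁ P₂ => P₁.Canonical B v ∧ P₂.Canonical B v
  | .opt P₁ P₂ => P₁.Canonical B v ∧ P₂.Canonical B v
  | .filter P C => P.Canonical B v ∧ C.Canonical B v

/-- Every scheme is contained in the domain of a canonical solution mapping. The domain may be
larger: in a graph in which the optional part of a pattern has a solution, it has a canonical
one, and this is compatible with all other canonical mappings. -/
theorem exists_canonicalMapping_mem_sem {F : Set ConstraintClass} (hF : .notBound ∉ F)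
    {G : RDFGraph I B L} {v : V → I} {P : Pattern I L V} (hP : P.InFragment F)
    (hG : P.instances B v ⊆ G.triples) (hv : P.Canonical B v) {S : List V} (hS : P.HasScheme S) :
    ∃ D, (∀ x ∈ S, x ∈ D) ∧ canonicalMapping B v D ∈ sem G P := by
  induction P generalizing S with
  | triple u p w =>
    obtain ⟨hu, rfl⟩ := hS
    refine ⟨_, fun x hx => hx, ?_, _, _, _, eval_canonicalMapping v ?_,
      eval_canonicalMapping v ?_, eval_canonicalMapping v ?_, hG ⟨hu, rfl⟩⟩
    · ext x
      rw [mem_dom_canonicalMapping]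
      simp only [List.mem_append, Set.mem_union, PTerm.mem_vars]
      tauto
    all_goals
      intro x hx
      simp [hx]
  | union P₁ P₂ h₁ h₂ =>
    have hG' := Set.union_subset_iff.1 hG
    rcases hS with hS | hS
    · obtain ⟨D, hD, h⟩ := h₁ hP.1 hG'.1 hv.1 hS
      exact ⟨D, hD, Or.inl h⟩
    · obtain ⟨D, hD, h⟩ := h₂ hP.2 hG'.2 hv.2 hS
      exact ⟨D, hD, Or.inr h⟩
  | and P₁ P₂ h₁ h₂ =>
    have hG' := Set.union_subset_iff.1 hG
    obtain ⟨S₁, S₂, hS₁, hS₂, rfl⟩ := hS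
    obtain ⟨D₁, hD₁, h₁⟩ := h₁ hP.1 hG'.1 hv.1 hS₁
    obtain ⟨D₂, hD₂, h₂⟩ := h₂ hP.2 hG'.2 hv.2 hS₂
    refine ⟨D₂ ++ D₁, fun x hx => ?_, _, h₁, _, h₂, canonicalMapping_compatible v _ _,
      (canonicalMapping_union v _ _).symm⟩
    rw [List.mem_append] at hx ⊢
    exact hx.imp (hD₂ x) (hD₁ x)
  | opt P₁ P₂ h₁ h₂ =>
    have hG' := Set.union_subset_iff.1 hG
    rcases hS with hS | ⟨S₁, S₂, hS₁, hS₂, rfl⟩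
    · obtain ⟨D₁, hD₁, h₁⟩ := h₁ hP.1 hG'.1 hv.1 hS
      -- If the optional part has a compatible solution, then it has a scheme, hence a canonical
      -- solution, and this is compatible as well.
      by_cases hc : ∃ μ₂ ∈ sem G P₂, (canonicalMapping B v D₁).Compatible μ₂
      · obtain ⟨μ₂, hμ₂, -⟩ := hc
        obtain ⟨S₂, hS₂, -⟩ := exists_hasScheme hF hP.2 hμ₂
        obtain ⟨D₂, hD₂, h₂⟩ := h₂ hP.2 hG'.2 hv.2 hS₂
        refine ⟨D₂ ++ D₁, fun x hx => List.mem_append_right _ (hD₁ x hx), Or.inl ⟨_, h₁, _, h₂,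
          canonicalMapping_compatible v _ _, (canonicalMapping_union v _ _).symm⟩⟩
      · exact ⟨D₁, hD₁, Or.inr ⟨h₁, hc⟩⟩
    · obtain ⟨D₁, hD₁, h₁⟩ := h₁ hP.1 hG'.1 hv.1 hS₁
      obtain ⟨D₂, hD₂, h₂⟩ := h₂ hP.2 hG'.2 hv.2 hS₂
      refine ⟨D₂ ++ D₁, fun x hx => ?_, Or.inl ⟨_, h₁, _, h₂, canonicalMapping_compatible v _ _,
        (canonicalMapping_union v _ _).symm⟩⟩
      rw [List.mem_append] at hx ⊢
      exact hx.imp (hD₂ x) (hD₁ x)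
  | filter P C h =>
    obtain ⟨D, hD, h⟩ := h hP.1 hG hv.1 hS.1
    exact ⟨D, hD, h, hv.2 D fun x hx => hD x (hS.2 x hx)⟩

end Semantics

/-! ### Satisfiability in the two fragments -/

/-- The class of equalities or of nonequalities. -/
def cmpClass : Bool → ConstraintClass
  | true => .eq
  | false => .ne

/-- The constraints in `SPARQL(bound, =, ≠_c)` or in `SPARQL(bound, ≠, ≠_c)`. -/
def fragment (e : Bool) : Set ConstraintClass := {.bound, cmpClass e, .neConst}

theorem notBound_notMem_fragment (e : Bool) : ConstraintClass.notBound ∉ fragment e := by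
  cases e <;> simp [fragment, cmpClass]

/-- The values given to the variables: the same for all, or pairwise distinct, and of length at
least `n`. -/
def valuation (e : Bool) (n : ℕ) (x : List Bool) : List Bool :=
  List.replicate n false ++ if e then [] else x

theorem canonical_of_cls_mem {B : Type*} {e : Bool} {C : BConstraint} (hC : C.cls ∈ fragment e)
    {n : ℕ} (hn : (encodeConstraint C).length ≤ n) : C.Canonical B (valuation e n) := by
  intro D hD
  cases C with
  | bound x => exact (mem_dom_canonicalMapping _ D x).2 (hD x (by simp [Constraint.varList]))
  | notBound x => exact absurd hC (notBound_notMem_fragment e)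
  | eqConst x c => cases e <;> simp [fragment, cmpClass, Constraint.cls] at hC
  | neConst x c =>
    have hx := hD x (by simp [Constraint.varList])
    refine ⟨(mem_dom_canonicalMapping _ D x).2 hx, ?_⟩
    rw [canonicalMapping_apply _ hx]
    cases c with
    | iri c =>
      -- The value of `x` is longer than the code of the constraint, hence differs from `c`.
      intro h
      have h : valuation e n x = c := by simpa [Mapping.eval, Const.toPTerm] using h
      have := congrArg List.length h
      simp [valuation, encodeConstraint, encodeTerm, Const.toPTerm] at this hn
      omega
    | lit c => simp [Mapping.eval, Const.toPTerm]
  | eq x y =>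
    have hx := hD x (by simp [Constraint.varList])
    have hy := hD y (by simp [Constraint.varList])
    have he : e = true := by cases e <;> simp [fragment, cmpClass, Constraint.cls] at hC ⊢
    refine ⟨(mem_dom_canonicalMapping _ D x).2 hx, (mem_dom_canonicalMapping _ D y).2 hy, ?_⟩
    rw [canonicalMapping_apply _ hx, canonicalMapping_apply _ hy]
    -- All variables have the same value.
    simp [valuation, he]
  | ne x y h =>
    have hx := hD x (by simp [Constraint.varList])
    have hy := hD y (by simp [Constraint.varList])
    have he : e = false := by cases e <;> simp [fragment, cmpClass, Constraint.cls] at hC ⊢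
    refine ⟨(mem_dom_canonicalMapping _ D x).2 hx, (mem_dom_canonicalMapping _ D y).2 hy, ?_⟩
    rw [canonicalMapping_apply _ hx, canonicalMapping_apply _ hy]
    -- Different variables have different values.
    simp [valuation, he, h]

theorem canonical_of_inFragment {B : Type*} {e : Bool} {P : BPattern}
    (hP : P.InFragment (fragment e)) {n : ℕ} (hn : (encodePattern P).length ≤ n) :
    P.Canonical B (valuation e n) := by
  induction P with
  | triple u v w => trivial
  | union P₁ P₂ h₁ h₂ =>
    simp only [encodePattern, List.length_append] at hn
    exact ⟨h₁ hP.1 (by omega), h₂ hP.2 (by omega)⟩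
  | and P₁ P₂ h₁ h₂ =>
    simp only [encodePattern, List.length_append] at hn
    exact ⟨h₁ hP.1 (by omega), h₂ hP.2 (by omega)⟩
  | opt P₁ P₂ h₁ h₂ =>
    simp only [encodePattern, List.length_append] at hn
    exact ⟨h₁ hP.1 (by omega), h₂ hP.2 (by omega)⟩
  | filter P C h =>
    simp only [encodePattern, List.length_append] at hn
    exact ⟨h hP.1 (by omega), canonical_of_cls_mem hP.2 (by omega)⟩

/-- Within the two fragments, a pattern is satisfiable if and only if it has a scheme. -/
theorem satisfiable_iff_exists_hasScheme (B : Type*) {e : Bool} {P : BPattern}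
    (hP : P.InFragment (fragment e)) : Satisfiable B P ↔ ∃ S, P.HasScheme S := by
  constructor
  · rintro ⟨G, μ, hμ⟩
    obtain ⟨S, hS, -⟩ := exists_hasScheme (notBound_notMem_fragment e) hP hμ
    exact ⟨S, hS⟩
  · rintro ⟨S, hS⟩
    obtain ⟨D, -, hD⟩ := exists_canonicalMapping_mem_sem (notBound_notMem_fragment e) hP
      (G := canonicalGraph B (valuation e _) P) subset_rfl (canonical_of_inFragment hP le_rfl) hS
    exact ⟨_, _, hD⟩

end SPARQL

/-! ### Executions of stack programs -/

namespace StackProgram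

open Language
open scoped Computability

variable {m : ℕ} {Γ : Type} {L M : Language (Act m Γ)} {s t s' : Fin m → List Γ} {n n' : ℕ}

/-- Some execution of the program `L` leads from the store `s` to the store `s'`. -/
def Exec (L : Language (Act m Γ)) (s s' : Fin m → List Γ) : Prop :=
  ∃ l ∈ L, execList s l = some s'

/-- Some execution of the program `L` of at most `n` actions leads from the store `s` to the
store `s'`. -/
def Runs (L : Language (Act m Γ)) (n : ℕ) (s s' : Fin m → List Γ) : Prop :=
  ∃ l ∈ L, l.length ≤ n ∧ execList s l = some s'

theorem execList_append (s : Fin m → List Γ) (l l' : List (Act m Γ)) :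
    execList s (l ++ l') = (execList s l).bind fun t => execList t l' := by
  induction l generalizing s with
  | nil => rfl
  | cons a l ih =>
    rw [List.cons_append, execList, execList]
    cases a.exec s with
    | none => rfl
    | some t => exact ih t

theorem exec_mul : Exec (L * M) s s' ↔ ∃ t, Exec L s t ∧ Exec M t s' := by
  constructor
  · rintro ⟨_, h, h'⟩
    obtain ⟨l, hl, l', hl', rfl⟩ := mem_mul.1 h
    rw [execList_append, Option.bind_eq_some_iff] at h'
    obtain ⟨t, ht, h'⟩ := h'
    exact ⟨t, ⟨l, hl, ht⟩, l', hl', h'⟩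
  · rintro ⟨t, ⟨l, hl, ht⟩, l', hl', h'⟩
    exact ⟨l ++ l', append_mem_mul hl hl', by simp [execList_append, ht, h']⟩

theorem exec_add : Exec (L + M) s s' ↔ Exec L s s' ∨ Exec M s s' := by
  simp only [Exec, mem_add, or_and_right, exists_or]

theorem exec_one : Exec 1 s s' ↔ s' = s := by
  constructor
  · rintro ⟨l, hl, h⟩
    rw [mem_one] at hl
    subst hl
    exact (Option.some_injective _ h).symm
  · rintro rfl
    exact ⟨[], nil_mem_one, rfl⟩

theorem exec_singleton (a : Act m Γ) : Exec {[a]} s s' ↔ a.exec s = some s' := by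
  constructor
  · rintro ⟨l, hl, h⟩
    have hl : l = [a] := hl
    subst hl
    simpa [execList] using h
  · intro h
    exact ⟨[a], rfl, by simpa [execList] using h⟩

theorem exec_sum {ι : Type*} (I : Finset ι) (L : ι → Language (Act m Γ)) :
    Exec (∑ i ∈ I, L i) s s' ↔ ∃ i ∈ I, Exec (L i) s s' := by
  classical
  induction I using Finset.induction_on with
  | empty => simp [Exec, notMem_zero]
  | insert i I hi ih =>
    rw [Finset.sum_insert hi, exec_add, ih]
    simp

/-- A property that holds initially and that the body of a loop preserves holds finally. -/
theorem Exec.kstar_induction {P : (Fin m → List Γ) → Prop} (h : Exec L∗ s s') (h0 : P s)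
    (step : ∀ t t', P t → Exec L t t' → P t') : P s' := by
  obtain ⟨_, hl, h⟩ := h
  obtain ⟨ls, rfl, hls⟩ := mem_kstar.1 hl
  clear hl
  induction ls generalizing s with
  | nil => exact Option.some_injective _ h ▸ h0
  | cons l ls ih =>
    rw [List.flatten_cons, execList_append, Option.bind_eq_some_iff] at h
    obtain ⟨t, ht, h⟩ := h
    exact ih (step s t h0 ⟨l, hls l (by simp), ht⟩) (fun y hy => hls y (by simp [hy])) h

theorem Exec.runs_of_singleton {a : Act m Γ} (h : Exec {[a]} s s') : Runs {[a]} 1 s s' := by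
  rw [exec_singleton] at h
  exact ⟨[a], rfl, le_rfl, by simpa [execList] using h⟩

theorem Runs.mono (h : Runs L n s s') (hn : n ≤ n') : Runs L n' s s' := by
  obtain ⟨l, hl, hln, h⟩ := h
  exact ⟨l, hl, hln.trans hn, h⟩

theorem Runs.mul (h : Runs L n s t) (h' : Runs M n' t s') : Runs (L * M) (n + n') s s' := by
  obtain ⟨l, hl, hn, h⟩ := h
  obtain ⟨l', hl', hn', h'⟩ := h'
  exact ⟨l ++ l', append_mem_mul hl hl', by simp; omega, by simp [execList_append, h, h']⟩

theorem Runs.add_left (h : Runs L n s s') : Runs (L + M) n s s' := by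
  obtain ⟨l, hl, h⟩ := h
  exact ⟨l, Or.inl hl, h⟩

theorem Runs.add_right (h : Runs M n s s') : Runs (L + M) n s s' := by
  obtain ⟨l, hl, h⟩ := h
  exact ⟨l, Or.inr hl, h⟩

theorem Runs.kstar_nil (L : Language (Act m Γ)) (s : Fin m → List Γ) : Runs L∗ 0 s s :=
  ⟨[], nil_mem_kstar L, le_rfl, rfl⟩

theorem Runs.kstar_cons (h : Runs L n s t) (h' : Runs L∗ n' t s') : Runs L∗ (n + n') s s' := by
  rw [← one_add_self_mul_kstar_eq_kstar]
  exact (h.mul h').add_right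

theorem Runs.kstar_single (h : Runs L n s s') : Runs L∗ n s s' :=
  h.kstar_cons (.kstar_nil L s')

theorem Runs.kstar_append (h : Runs L∗ n s t) (h' : Runs L∗ n' t s') :
    Runs L∗ (n + n') s s' := by
  rw [← kstar_mul_kstar]
  exact h.mul h'

theorem Runs.sum {ι : Type*} {I : Finset ι} {L : ι → Language (Act m Γ)} {i : ι} (hi : i ∈ I)
    (h : Runs (L i) n s s') : Runs (∑ i ∈ I, L i) n s s' := by
  classical
  rw [← Finset.add_sum_erase _ _ hi]
  exact h.add_left

/-- The program that pushes `a` on stack `k`. -/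
def push (k : Fin m) (a : Γ) : Language (Act m Γ) := {[.push k a]}

/-- The program that removes `a` from the top of stack `k`. -/
def pop (k : Fin m) (a : Γ) : Language (Act m Γ) := {[.pop k a]}

/-- The program that tests whether stack `k` is empty. -/
def empty (k : Fin m) : Language (Act m Γ) := {[.empty k]}

/-- Sequential composition. -/
def seq (Ls : List (Language (Act m Γ))) : Language (Act m Γ) := Ls.prod

variable {Ls : List (Language (Act m Γ))}

@[simp] theorem exec_seq_nil : Exec (seq []) s s' ↔ s' = s := exec_one

theorem exec_seq_cons : Exec (seq (L :: Ls)) s s' ↔ ∃ t, Exec L s t ∧ Exec (seq Ls) t s' := by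
  rw [seq, List.prod_cons, exec_mul, seq]

theorem exec_push {k : Fin m} {a : Γ} :
    Exec (push k a) s s' ↔ s' = Function.update s k (a :: s k) := by
  simp [push, exec_singleton, Act.exec, eq_comm]

theorem exec_pop {k : Fin m} {a : Γ} :
    Exec (pop k a) s s' ↔ ∃ l, s k = a :: l ∧ s' = Function.update s k l := by
  rw [pop, exec_singleton, Act.exec]
  cases s k with
  | nil => simp
  | cons b l =>
    by_cases h : b = a
    · simp [h, eq_comm]
    · simp [h]

theorem exec_empty {k : Fin m} : Exec (empty k) s s' ↔ s k = [] ∧ s' = s := by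
  by_cases h : s k = [] <;> simp [empty, exec_singleton, Act.exec, h, eq_comm]

@[simp] theorem exec_seq_push {k : Fin m} {a : Γ} : Exec (seq (push k a :: Ls)) s s' ↔
    Exec (seq Ls) (Function.update s k (a :: s k)) s' := by
  simp [exec_seq_cons, exec_push]

@[simp] theorem exec_seq_pop {k : Fin m} {a : Γ} : Exec (seq (pop k a :: Ls)) s s' ↔
    ∃ l, s k = a :: l ∧ Exec (seq Ls) (Function.update s k l) s' := by
  simp only [exec_seq_cons, exec_pop]
  constructor
  · rintro ⟨t, ⟨l, hl, rfl⟩, h⟩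
    exact ⟨l, hl, h⟩
  · rintro ⟨l, hl, h⟩
    exact ⟨_, ⟨l, hl, rfl⟩, h⟩

@[simp] theorem exec_seq_empty {k : Fin m} : Exec (seq (empty k :: Ls)) s s' ↔
    s k = [] ∧ Exec (seq Ls) s s' := by
  simp only [exec_seq_cons, exec_empty]
  constructor
  · rintro ⟨t, ⟨hl, rfl⟩, h⟩
    exact ⟨hl, h⟩
  · rintro ⟨hl, h⟩
    exact ⟨_, ⟨hl, rfl⟩, h⟩

theorem Runs.seq_nil (s : Fin m → List Γ) : Runs (seq []) 0 s s :=
  ⟨[], nil_mem_one, le_rfl, rfl⟩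

theorem Runs.seq_cons (h : Runs L n s t) (h' : Runs (seq Ls) n' t s') :
    Runs (seq (L :: Ls)) (n + n') s s' := by
  rw [seq, List.prod_cons]
  exact h.mul h'

theorem isRegular_seq_nil : (seq [] : Language (Act m Γ)).IsRegular := isRegular_one

theorem isRegular_seq_cons (h : L.IsRegular) (h' : (seq Ls).IsRegular) :
    (seq (L :: Ls)).IsRegular := by
  rw [seq, List.prod_cons]
  exact h.mul h'

theorem isRegular_push (k : Fin m) (a : Γ) : (push k a).IsRegular := isRegular_singleton _

theorem isRegular_pop (k : Fin m) (a : Γ) : (pop k a).IsRegular := isRegular_singleton _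

theorem isRegular_empty (k : Fin m) : (empty k : Language (Act m Γ)).IsRegular :=
  isRegular_singleton _

end StackProgram

/-! ### A program recognizing satisfiable patterns -/

namespace SPARQL

open StackProgram
open scoped Computability

/-- Programs on four stacks of symbols: an auxiliary stack (number `0`, initially with the
reversed input), the input (number `1`), the main stack (number `2`), and a stack `3` on which
the names of the variables of filter conditions are recorded. -/
abbrev Prog := Language (Act 4 Sym)

/-- The store with the given contents of the auxiliary stack, the input, the main stack, and the
stack of recorded names. -/
def st (A X T Z : List Sym) : Fin 4 → List Sym := ![A, X, T, Z]

/-- A list of bits as a list of symbols. -/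
abbrev bits (m : List Bool) : List Sym := m.map .bit

/-- The names listed by `S`, on the main stack, last symbols first. -/
def encodeNames (S : List (List Bool)) : List Sym :=
  S.flatMap fun m => (bits m).reverse ++ [.var]

/-- The representation on the main stack of a pattern that is part of the input read so far:
the mark `union` if the pattern is *dead*, i.e. not required to have a solution, and the mark `and`
on top of a scheme of the pattern if it is *live*. The two symbols merely serve as marks. -/
def encodeBlock : Option (List (List Bool)) → List Sym
  | none => [.union]
  | some S => .and :: encodeNames S

/-- Any number of executions of `f false` and `f true`, in any order. -/
def loop (f : Bool → List Prog) : Prog := (seq (f false) + seq (f true))∗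

/-- Read the rest of a name from the input. -/
def skipBits : Prog := loop fun b => [pop 1 (.bit b)]

/-- Read a term of sort `a`. -/
def skipTerm (a : Sym) : Prog := seq [pop 1 a, skipBits]

/-- Read a variable, and put it on the main stack. -/
def copyVar : Prog :=
  seq [pop 1 .var, push 2 .var, loop fun b => [pop 1 (.bit b), push 2 (.bit b)]]

/-- Read a triple pattern; make it a dead block. -/
def deadTriple : Prog :=
  seq [skipTerm .iri + skipTerm .lit + skipTerm .var, skipTerm .iri + skipTerm .var,
    skipTerm .iri + skipTerm .lit + skipTerm .var, pop 1 .triple, push 2 .union]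

/-- Read a triple pattern whose subject is not a literal; make it a live block. -/
def liveTriple : Prog :=
  seq [skipTerm .iri + copyVar, skipTerm .iri + copyVar,
    skipTerm .iri + skipTerm .lit + copyVar, pop 1 .triple, push 2 .and]

/-- Move bits from the main stack to the auxiliary stack. -/
def downBits : Prog := loop fun b => [pop 2 (.bit b), push 0 (.bit b)]

/-- Move some names from the main stack to the auxiliary stack. -/
def down : Prog := (seq [downBits, pop 2 .var, push 0 .var])∗

/-- Move all names back from the auxiliary stack to the main stack. This fails if the auxiliary
stack has a bit on top. -/
def up : Prog :=
  seq [(seq [pop 0 .var, push 2 .var, loop fun b => [pop 0 (.bit b), push 2 (.bit b)]])∗, empty 0]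

/-- Remove the mark `a` below a live topmost block. -/
def joinBelow (a : Sym) : Prog := seq [pop 2 .and, down, pop 2 a, up, push 2 .and]

/-- Remove a dead block that is not the only block. -/
def dropDead : Prog := seq [pop 2 .union, seq [pop 2 .and, push 2 .and] +
  seq [pop 2 .union, push 2 .union]]

/-- Read `union`. At most one of the two patterns is live. -/
def unionStep : Prog := seq [pop 1 .union, dropDead + joinBelow .union]

/-- Read `and`. The two patterns are both live or both dead. -/
def andStep : Prog :=
  seq [pop 1 .and, seq [pop 2 .union, pop 2 .union, push 2 .union] + joinBelow .and]

/-- Read `opt`. If the second pattern is live, then the first one is live. -/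
def optStep : Prog := seq [pop 1 .opt, dropDead + joinBelow .and]

/-- Read a variable of a filter condition of a dead pattern, and record it. -/
def deadName : Prog :=
  seq [pop 2 .union, push 2 .union, pop 1 .var, push 3 .var,
    loop fun b => [pop 1 (.bit b), push 3 (.bit b)]]

/-- Read a variable of a filter condition of a live pattern, record it, and verify that it belongs
to the scheme of the pattern: part of the scheme is moved to the auxiliary stack, so that the
first bit of one of the names gets on top, and the moved bits of this name are moved back while
they are compared with the input. Since `up` fails if a bit is left on top of the
auxiliary stack, the whole name has been compared then. -/
def liveName : Prog :=
  seq [pop 2 .and, down, downBits, pop 2 .var, push 2 .var, pop 1 .var, push 3 .var,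
    loop fun b => [pop 0 (.bit b), pop 1 (.bit b), push 2 (.bit b), push 3 (.bit b)],
    up, push 2 .and]

/-- Read a variable of a filter condition. -/
def readName : Prog := deadName + liveName

/-- Remove from the recorded names the rest of a name, which starts with `d`, and is empty if `d` is
`none`. -/
def dropName : Option Bool → Prog
  | none => seq [pop 3 .var]
  | some b => seq [pop 3 (.bit b), loop fun b => [pop 3 (.bit b)], pop 3 .var]

/-- Remove two names from the recorded names, without the bits that have been moved from the
first one to the auxiliary stack. The names are compared at the position given by the number of
these bits: the first name has there the entry `d`, and the second one has `d₁` or `d₂`. -/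
def dropNames (d d₁ d₂ : Option Bool) : Prog :=
  seq [dropName d, loop fun b => [pop 3 (.bit b), pop 0 (.bit false) + pop 0 (.bit true)],
    empty 0, dropName d₁ + dropName d₂]

/-- Verify that the last two recorded names differ, and remove them. On the stack, names are written
backwards. A guessed number of bits of the upper name, up to the first difference, is moved to the
auxiliary stack, where only their number matters; the entries of both names at this position are
guessed to differ in one of the possible ways, a name that ends there having the entry `none`. -/
def differ : Prog :=
  seq [loop fun b => [pop 3 (.bit b), push 0 (.bit b)],
    dropNames none (some false) (some true) + dropNames (some false) none (some true) +
      dropNames (some true) none (some false)]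

/-- Read a condition of the class `bound`. -/
def boundStep : Prog := seq [readName, pop 1 .bound]

/-- Read a condition of the class `≠_c`. -/
def neConstStep : Prog := seq [readName, skipTerm .iri + skipTerm .lit, pop 1 .neConst]

/-- Read a condition of the class `=`, respectively `≠`. -/
def cmpStep : Bool → Prog
  | true => seq [readName, readName, pop 1 .eq]
  | false => seq [readName, readName, pop 1 .ne, differ]

/-- Read a triple pattern, an operator, or a filter condition. -/
def step (e : Bool) : Prog :=
  deadTriple + liveTriple + unionStep + andStep + optStep + boundStep + neConstStep + cmpStep e

/-- Move the input from the auxiliary stack to its own stack. -/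
def loadInput : Prog := seq [(∑ a : Sym, seq [pop 0 a, push 1 a])∗, empty 0]

/-- A program that accepts the codes of the satisfiable patterns of the fragment number `e`: it
guesses for each triple pattern whether it is live, computes schemes, and verifies that the whole
input is one live pattern. -/
def program (e : Bool) : Prog :=
  seq [loadInput, (step e)∗, empty 1, pop 2 .and, down, empty 2]

/-! ### Regularity of the program -/

theorem isRegular_loop {f : Bool → List Prog} (h : ∀ b, (seq (f b)).IsRegular) :
    (loop f).IsRegular :=
  ((h false).add (h true)).kstar

theorem isRegular_program (e : Bool) : (program e).IsRegular := by
  have hT : ∀ a, (skipTerm a).IsRegular := fun a => by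
    simp only [skipTerm, skipBits]
    repeat first
      | apply isRegular_pop | apply isRegular_seq_nil | apply isRegular_seq_cons
      | apply isRegular_loop | intro
  have hV : copyVar.IsRegular := by
    simp only [copyVar]
    repeat first
      | apply isRegular_pop | apply isRegular_push | apply isRegular_seq_nil
      | apply isRegular_seq_cons | apply isRegular_loop | intro
  have hDB : downBits.IsRegular := by
    simp only [downBits]
    repeat first
      | apply isRegular_pop | apply isRegular_push | apply isRegular_seq_nil
      | apply isRegular_seq_cons | apply isRegular_loop | intro
  have hD : down.IsRegular := by
    refine Language.IsRegular.kstar ?_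
    repeat first
      | exact hDB | apply isRegular_pop | apply isRegular_push | apply isRegular_seq_nil
      | apply isRegular_seq_cons
  have hU : up.IsRegular := by
    simp only [up]
    repeat first
      | apply isRegular_pop | apply isRegular_push | apply isRegular_empty
      | apply isRegular_seq_nil | apply isRegular_seq_cons | apply isRegular_loop
      | apply Language.IsRegular.kstar | intro
  have hJ : ∀ a, (joinBelow a).IsRegular := fun a => by
    simp only [joinBelow]
    repeat first
      | exact hD | exact hU | apply isRegular_pop | apply isRegular_push
      | apply isRegular_seq_nil | apply isRegular_seq_cons
  have hDD : dropDead.IsRegular := by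
    simp only [dropDead]
    repeat first
      | apply isRegular_pop | apply isRegular_push
      | apply isRegular_seq_nil | apply isRegular_seq_cons | apply Language.IsRegular.add
  have hN : readName.IsRegular := by
    simp only [readName, deadName, liveName]
    repeat first
      | exact hD | exact hU | exact hDB | apply isRegular_pop | apply isRegular_push
      | apply isRegular_seq_nil | apply isRegular_seq_cons | apply Language.IsRegular.add
      | apply isRegular_loop | intro
  have hDN : ∀ d, (dropName d).IsRegular := fun d => by
    cases d <;> simp only [dropName] <;>
    repeat first
      | apply isRegular_pop | apply isRegular_seq_nil | apply isRegular_seq_cons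
      | apply isRegular_loop | intro
  have hDF : differ.IsRegular := by
    simp only [differ, dropNames]
    repeat first
      | apply hDN | apply isRegular_pop | apply isRegular_push | apply isRegular_empty
      | apply isRegular_seq_nil | apply isRegular_seq_cons | apply Language.IsRegular.add
      | apply isRegular_loop | intro
  have hC : (cmpStep e).IsRegular := by
    cases e <;> simp only [cmpStep] <;>
    repeat first
      | exact hN | exact hDF | apply isRegular_pop
      | apply isRegular_seq_nil | apply isRegular_seq_cons
  have hS : (step e).IsRegular := by
    simp only [step, deadTriple, liveTriple, unionStep, andStep, optStep, boundStep, neConstStep]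
    repeat first
      | exact hN | exact hC | exact hDD | apply hJ | apply hT | exact hV | apply isRegular_pop
      | apply isRegular_push | apply isRegular_seq_nil | apply isRegular_seq_cons
      | apply Language.IsRegular.add
  have hL : loadInput.IsRegular := by
    refine isRegular_seq_cons (Language.IsRegular.kstar ?_)
      (isRegular_seq_cons (isRegular_empty _) isRegular_seq_nil)
    refine Language.isRegular_sum _ _ fun a => ?_
    repeat first
      | apply isRegular_pop | apply isRegular_push | apply isRegular_seq_nil
      | apply isRegular_seq_cons
  exact isRegular_seq_cons hL <| isRegular_seq_cons hS.kstar <|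
    isRegular_seq_cons (isRegular_empty _) <| isRegular_seq_cons (isRegular_pop _ _) <|
    isRegular_seq_cons hD <| isRegular_seq_cons (isRegular_empty _) isRegular_seq_nil

end SPARQL

/-! ### Soundness of the program -/

namespace SPARQL

open StackProgram
open scoped Computability

section Store

variable (A X T Z l : List Sym)

@[simp] theorem st_zero : st A X T Z 0 = A := rfl

@[simp] theorem st_one : st A X T Z 1 = X := rfl

@[simp] theorem st_two : st A X T Z 2 = T := rfl

@[simp] theorem st_three : st A X T Z 3 = Z := rfl

@[simp] theorem update_st_zero : Function.update (st A X T Z) 0 l = st l X T Z := by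
  funext k; fin_cases k <;> rfl

@[simp] theorem update_st_one : Function.update (st A X T Z) 1 l = st A l T Z := by
  funext k; fin_cases k <;> rfl

@[simp] theorem update_st_two : Function.update (st A X T Z) 2 l = st A X l Z := by
  funext k; fin_cases k <;> rfl

@[simp] theorem update_st_three : Function.update (st A X T Z) 3 l = st A X T l := by
  funext k; fin_cases k <;> rfl

end Store

variable {A X T Z A' X' T' Z' : List Sym} {s s' : Fin 4 → List Sym}

/-- Induction over the bits processed by a loop. -/
theorem exec_loop_induction {f : Bool → List Prog} {P : List Bool → (Fin 4 → List Sym) → Prop}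
    (h : Exec (loop f) s s') (h0 : P [] s)
    (hstep : ∀ u b t t', P u t → Exec (seq (f b)) t t' → P (u ++ [b]) t') : ∃ u, P u s' := by
  refine Exec.kstar_induction (P := fun t => ∃ u, P u t) h ⟨[], h0⟩ ?_
  rintro t t' ⟨u, hu⟩ ht
  rcases exec_add.1 ht with ht | ht
  exacts [⟨_, hstep u false t t' hu ht⟩, ⟨_, hstep u true t t' hu ht⟩]

theorem exec_skipBits (h : Exec skipBits (st A X T Z) s') :
    ∃ u X', X = bits u ++ X' ∧ s' = st A X' T Z := by
  refine exec_loop_induction (P := fun u t => ∃ X', X = bits u ++ X' ∧ t = st A X' T Z)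
    h ⟨X, by simp⟩ ?_
  rintro u b _ t' ⟨X', rfl, rfl⟩ h
  simp at h
  obtain ⟨l, rfl, rfl⟩ := h
  exact ⟨l, by simp⟩

theorem exec_copyBits
    (h : Exec (loop fun b => [pop 1 (.bit b), push 2 (.bit b)]) (st A X T Z) s') :
    ∃ u X', X = bits u ++ X' ∧ s' = st A X' ((bits u).reverse ++ T) Z := by
  refine exec_loop_induction
    (P := fun u t => ∃ X', X = bits u ++ X' ∧ t = st A X' ((bits u).reverse ++ T) Z)
    h ⟨X, by simp⟩ ?_
  rintro u b _ t' ⟨X', rfl, rfl⟩ h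
  simp at h
  obtain ⟨l, rfl, rfl⟩ := h
  exact ⟨l, by simp⟩

theorem exec_recordBits
    (h : Exec (loop fun b => [pop 1 (.bit b), push 3 (.bit b)]) (st A X T Z) s') :
    ∃ u X', X = bits u ++ X' ∧ s' = st A X' T ((bits u).reverse ++ Z) := by
  refine exec_loop_induction
    (P := fun u t => ∃ X', X = bits u ++ X' ∧ t = st A X' T ((bits u).reverse ++ Z))
    h ⟨X, by simp⟩ ?_
  rintro u b _ t' ⟨X', rfl, rfl⟩ h
  simp at h
  obtain ⟨l, rfl, rfl⟩ := h
  exact ⟨l, by simp⟩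

theorem exec_downBits (h : Exec downBits (st A X T Z) s') :
    ∃ u T', T = bits u ++ T' ∧ s' = st ((bits u).reverse ++ A) X T' Z := by
  refine exec_loop_induction
    (P := fun u t => ∃ T', T = bits u ++ T' ∧ t = st ((bits u).reverse ++ A) X T' Z)
    h ⟨T, by simp⟩ ?_
  rintro u b _ t' ⟨T', rfl, rfl⟩ h
  simp at h
  obtain ⟨l, rfl, rfl⟩ := h
  exact ⟨l, by simp⟩

theorem exec_compareBits (h : Exec (loop fun b => [pop 0 (.bit b), pop 1 (.bit b),
    push 2 (.bit b), push 3 (.bit b)]) (st A X T Z) s') :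
    ∃ u A' X', A = bits u ++ A' ∧ X = bits u ++ X' ∧
      s' = st A' X' ((bits u).reverse ++ T) ((bits u).reverse ++ Z) := by
  refine exec_loop_induction
    (P := fun u t => ∃ A' X', A = bits u ++ A' ∧ X = bits u ++ X' ∧
      t = st A' X' ((bits u).reverse ++ T) ((bits u).reverse ++ Z))
    h ⟨A, X, by simp⟩ ?_
  rintro u b _ t' ⟨A', X', rfl, rfl, rfl⟩ h
  simp at h
  obtain ⟨l, rfl, l', rfl, rfl⟩ := h
  exact ⟨l, l', by simp⟩

theorem exec_countBits
    (h : Exec (loop fun b => [pop 3 (.bit b), push 0 (.bit b)]) (st A X T Z) s') :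
    ∃ u Z', Z = bits u ++ Z' ∧ s' = st ((bits u).reverse ++ A) X T Z' := by
  refine exec_loop_induction
    (P := fun u t => ∃ Z', Z = bits u ++ Z' ∧ t = st ((bits u).reverse ++ A) X T Z')
    h ⟨Z, by simp⟩ ?_
  rintro u b _ t' ⟨Z', rfl, rfl⟩ h
  simp at h
  obtain ⟨l, rfl, rfl⟩ := h
  exact ⟨l, by simp⟩

theorem exec_countDownBits (h : Exec (loop fun b => [pop 3 (.bit b),
    pop 0 (.bit false) + pop 0 (.bit true)]) (st A X T Z) s') :
    ∃ u A' Z', Z = bits u ++ Z' ∧ A.length = u.length + A'.length ∧ s' = st A' X T Z' := by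
  refine exec_loop_induction
    (P := fun u t => ∃ A' Z', Z = bits u ++ Z' ∧ A.length = u.length + A'.length ∧
      t = st A' X T Z')
    h ⟨A, Z, by simp⟩ ?_
  rintro u b _ t' ⟨A', Z', rfl, hA, rfl⟩ h
  rw [exec_seq_pop] at h
  obtain ⟨l, hl, h⟩ := h
  rw [exec_seq_cons] at h
  obtain ⟨_, h, h'⟩ := h
  rw [exec_seq_nil] at h'
  subst h'
  simp at hl
  subst hl
  rcases exec_add.1 h with h | h
  all_goals
    rw [exec_pop] at h
    simp at h
    obtain ⟨l', rfl, rfl⟩ := h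
    exact ⟨l', l, by simp, by simp at hA ⊢; omega, rfl⟩

theorem exec_dropBits (h : Exec (loop fun b => [pop 3 (.bit b)]) (st A X T Z) s') :
    ∃ u Z', Z = bits u ++ Z' ∧ s' = st A X T Z' := by
  refine exec_loop_induction (P := fun u t => ∃ Z', Z = bits u ++ Z' ∧ t = st A X T Z')
    h ⟨Z, by simp⟩ ?_
  rintro u b _ t' ⟨Z', rfl, rfl⟩ h
  simp at h
  obtain ⟨l, rfl, rfl⟩ := h
  exact ⟨l, by simp⟩

theorem exec_skipTerm {a : Sym} (h : Exec (skipTerm a) (st A X T Z) s') :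
    ∃ u X', X = a :: (bits u ++ X') ∧ s' = st A X' T Z := by
  simp [skipTerm, exec_seq_cons (L := skipBits)] at h
  obtain ⟨l, rfl, h⟩ := h
  obtain ⟨u, X', rfl, rfl⟩ := exec_skipBits h
  exact ⟨u, X', rfl, rfl⟩

theorem exec_copyVar (h : Exec copyVar (st A X T Z) s') :
    ∃ u X', X = encodeTerm (.var u) ++ X' ∧ s' = st A X' (encodeNames [u] ++ T) Z := by
  simp [copyVar, exec_seq_cons (L := loop _)] at h
  obtain ⟨l, rfl, h⟩ := h
  obtain ⟨u, X', rfl, rfl⟩ := exec_copyBits h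
  exact ⟨u, X', rfl, by simp [encodeNames]⟩

theorem encodeNames_cons (m : List Bool) (S : List (List Bool)) :
    encodeNames (m :: S) = (bits m).reverse ++ .var :: encodeNames S := by
  simp [encodeNames]

theorem encodeNames_append (S S' : List (List Bool)) :
    encodeNames (S ++ S') = encodeNames S ++ encodeNames S' := by
  simp [encodeNames]

/-- The list does not start with a bit. -/
def NoBit (l : List Sym) : Prop := ∀ b, l.head? ≠ some (.bit b)

/-- Names are determined by the symbols following their bits. -/
theorem bits_append_inj {u v : List Bool} {l l' : List Sym} (hl : NoBit l) (hl' : NoBit l')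
    (h : bits u ++ l = bits v ++ l') : u = v ∧ l = l' := by
  induction u generalizing v with
  | nil =>
    cases v with
    | nil => exact ⟨rfl, by simpa using h⟩
    | cons b v => exact absurd (by simp at h; simp [h]) (hl b)
  | cons a u ih =>
    cases v with
    | nil => exact absurd (by simp at h; simp [← h]) (hl' a)
    | cons b v =>
      simp at h
      obtain ⟨rfl, h⟩ := h
      obtain ⟨rfl, hll⟩ := ih (v := v) (by simpa using h)
      exact ⟨rfl, hll⟩

theorem noBit_cons {a : Sym} (ha : ∀ b, a ≠ .bit b) (l : List Sym) : NoBit (a :: l) := by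
  intro b h
  exact ha b (Option.some_injective _ h)

theorem noBit_nil : NoBit [] := by simp [NoBit]

/-- The list starts with a mark, if it is not empty. -/
def Marked (l : List Sym) : Prop := ∀ a ∈ l.head?, a = .and ∨ a = .union

theorem Marked.noBit (h : Marked T) : NoBit T := by
  intro b hb
  simpa using h _ hb

/-- The first name on the main stack, if the stack does not start with a mark. -/
theorem exists_cons_of_encodeNames_append {S : List (List Bool)} {u : List Bool} (hT : Marked T)
    (h : encodeNames S ++ T = bits u ++ .var :: T') :
    ∃ S', S = u.reverse :: S' ∧ T' = encodeNames S' ++ T := by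
  cases S with
  | nil =>
    obtain ⟨-, h⟩ := bits_append_inj (u := []) hT.noBit
      (noBit_cons (a := .var) (by simp) _) (by simpa [encodeNames] using h)
    simpa using hT .var (by simp [h])
  | cons m S =>
    rw [encodeNames_cons, List.append_assoc, ← List.map_reverse, List.cons_append] at h
    obtain ⟨rfl, h⟩ := bits_append_inj (noBit_cons (by simp) _) (noBit_cons (by simp) _) h
    exact ⟨S, by simp, by simpa using h.symm⟩

theorem exec_down {S : List (List Bool)} (hT : Marked T)
    (h : Exec down (st A X (encodeNames S ++ T) Z) s') :
    ∃ S₁ S₂, S = S₁ ++ S₂ ∧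
      s' = st ((encodeNames S₁).reverse ++ A) X (encodeNames S₂ ++ T) Z := by
  refine Exec.kstar_induction (P := fun t => ∃ S₁ S₂, S = S₁ ++ S₂ ∧
      t = st ((encodeNames S₁).reverse ++ A) X (encodeNames S₂ ++ T) Z) h
    ⟨[], S, by simp [encodeNames]⟩ ?_
  rintro _ t' ⟨S₁, S₂, rfl, rfl⟩ h
  rw [exec_seq_cons] at h
  obtain ⟨_, h, h'⟩ := h
  obtain ⟨u, T', hT', rfl⟩ := exec_downBits h
  simp at h'
  obtain ⟨T', rfl, rfl⟩ := h'
  obtain ⟨S', rfl, rfl⟩ := exists_cons_of_encodeNames_append hT hT'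
  exact ⟨S₁ ++ [u.reverse], S', by simp, by simp [encodeNames]⟩

/-- The execution of `up` starts with popping the symbol `var` unless the auxiliary stack is empty. -/
theorem exec_up (h : Exec up (st A X T Z) s') :
    s' = st [] X (A.reverse ++ T) Z ∧ NoBit A := by
  rw [up, exec_seq_cons] at h
  obtain ⟨_, h, h'⟩ := h
  suffices H : ∃ A' T', A.reverse ++ T = A'.reverse ++ T' ∧ (A' = A ∨ NoBit A) ∧
      ∃ t, t = st A' X T' Z ∧ Exec (seq [empty 0]) t s' by
    obtain ⟨A', T', hA, hN, _, rfl, h'⟩ := H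
    simp at h'
    obtain ⟨rfl, rfl⟩ := h'
    refine ⟨by rw [hA]; rfl, hN.elim (fun h => h ▸ noBit_nil) id⟩
  refine (Exec.kstar_induction (P := fun t => ∃ A' T', A.reverse ++ T = A'.reverse ++ T' ∧
    (A' = A ∨ NoBit A) ∧ t = st A' X T' Z) h ⟨A, T, rfl, Or.inl rfl, rfl⟩ ?_).imp fun A' => ?_
  · rintro _ t' ⟨A', T', hA, hN, rfl⟩ h
    simp [exec_seq_cons (L := loop _)] at h
    obtain ⟨A', rfl, h⟩ := h
    have hN' : NoBit A := hN.elim (fun h => h ▸ noBit_cons (by simp) _) id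
    have : ∃ u A'', A' = bits u ++ A'' ∧ t' = st A'' X ((bits u).reverse ++ .var :: T') Z := by
      obtain ⟨u, A'', hu⟩ := exec_loop_induction
        (P := fun u t => ∃ A'', A' = bits u ++ A'' ∧
          t = st A'' X ((bits u).reverse ++ .var :: T') Z) h ⟨A', by simp⟩ (by
        rintro u b _ t' ⟨A'', rfl, rfl⟩ h
        simp at h
        obtain ⟨l, rfl, rfl⟩ := h
        exact ⟨l, by simp⟩)
      exact ⟨u, A'', hu⟩
    obtain ⟨u, A'', rfl, rfl⟩ := this
    exact ⟨_, _, by rw [hA]; simp, Or.inr hN', rfl⟩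
  · rintro ⟨T', hA, hN, rfl⟩
    exact ⟨T', hA, hN, _, rfl, h'⟩

theorem noBit_reverse_encodeNames (S : List (List Bool)) : NoBit (encodeNames S).reverse := by
  rcases S.eq_nil_or_concat with rfl | ⟨S, m, rfl⟩
  · exact noBit_nil
  · rw [List.concat_eq_append, encodeNames_append]
    simp only [encodeNames, List.flatMap_cons, List.flatMap_nil, List.reverse_append,
      List.reverse_cons, List.reverse_nil, List.nil_append]
    exact noBit_cons (by simp) _

/-! ### Blocks -/

/-- The patterns read so far, the last one first, together with their schemes if they are
live. -/
abbrev Block := BPattern × Option (List (List Bool))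

/-- The contents of the main stack. -/
def encodeBlocks (l : List Block) : List Sym := l.flatMap fun i => encodeBlock i.2

/-- The input that has been read. -/
def consumed : List Block → List Sym
  | [] => []
  | i :: l => consumed l ++ encodePattern i.1

/-- The block contains a pattern of the fragment, and a scheme of the pattern if it is live. -/
def Block.Valid (e : Bool) (i : Block) : Prop :=
  i.1.InFragment (fragment e) ∧ ∀ S, i.2 = some S → i.1.HasScheme S

theorem encodeBlocks_cons (P : BPattern) (o : Option (List (List Bool))) (l : List Block) :
    encodeBlocks ((P, o) :: l) = encodeBlock o ++ encodeBlocks l := rfl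

theorem marked_encodeBlocks (l : List Block) : Marked (encodeBlocks l) := by
  rcases l with _ | ⟨⟨P, _ | S⟩, l⟩ <;> simp [encodeBlocks, encodeBlock, Marked]

theorem exists_of_encodeBlocks_eq_union_cons {l : List Block}
    (h : encodeBlocks l = .union :: T) :
    ∃ P l', l = (P, none) :: l' ∧ T = encodeBlocks l' := by
  rcases l with _ | ⟨⟨P, _ | S⟩, l⟩
  · simp [encodeBlocks] at h
  · exact ⟨P, l, rfl, by simpa [encodeBlocks, encodeBlock, eq_comm] using h⟩
  · simp [encodeBlocks, encodeBlock] at h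

theorem exists_of_encodeBlocks_eq_and_cons {l : List Block} (h : encodeBlocks l = .and :: T) :
    ∃ P S l', l = (P, some S) :: l' ∧ T = encodeNames S ++ encodeBlocks l' := by
  rcases l with _ | ⟨⟨P, _ | S⟩, l⟩
  · simp [encodeBlocks] at h
  · simp [encodeBlocks, encodeBlock] at h
  · exact ⟨P, S, l, rfl, by simpa [encodeBlocks, encodeBlock, eq_comm] using h⟩

theorem exec_joinBelow {a : Sym} (ha : a = .and ∨ a = .union) {l : List Block}
    (h : Exec (joinBelow a) (st [] X (encodeBlocks l) Z) s') :
    ∃ P S l' T, l = (P, some S) :: l' ∧ encodeBlocks l' = a :: T ∧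
      s' = st [] X (.and :: (encodeNames S ++ T)) Z := by
  rw [joinBelow, exec_seq_pop] at h
  obtain ⟨T, hT, h⟩ := h
  obtain ⟨P, S, l', rfl, rfl⟩ := exists_of_encodeBlocks_eq_and_cons hT
  simp [exec_seq_cons (L := down)] at h
  obtain ⟨_, h, h'⟩ := h
  obtain ⟨S₁, S₂, rfl, rfl⟩ := exec_down (marked_encodeBlocks l') h
  simp [exec_seq_cons (L := up)] at h'
  obtain ⟨T', hT', _, h, rfl⟩ := h'
  obtain ⟨rfl, -⟩ := exec_up h
  -- A nonempty list of names starts with a bit or with `var` on the stack; so if `a` can be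
  -- removed, all names of the scheme have been moved.
  have hS₂ : S₂ = [] := by
    rcases S₂ with _ | ⟨m, S₂⟩
    · rfl
    · rw [encodeNames_cons, List.append_assoc, ← List.map_reverse] at hT'
      rcases hm : m.reverse with _ | ⟨b, m'⟩ <;> rw [hm] at hT' <;> rcases ha with rfl | rfl <;>
        simp at hT'
  subst hS₂
  exact ⟨P, _, l', T', rfl, by simpa [encodeNames] using hT', by simp⟩

theorem exec_dropDead {l : List Block} (h : Exec dropDead (st [] X (encodeBlocks l) Z) s') :
    ∃ P Q o l', l = (P, none) :: (Q, o) :: l' ∧ s' = st [] X (encodeBlocks ((Q, o) :: l')) Z := by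
  rw [dropDead, exec_seq_pop] at h
  obtain ⟨T, hT, h⟩ := h
  obtain ⟨P, l', rfl, rfl⟩ := exists_of_encodeBlocks_eq_union_cons hT
  rw [exec_seq_cons] at h
  obtain ⟨_, h, h'⟩ := h
  rw [exec_seq_nil] at h'
  subst h'
  rcases exec_add.1 h with h | h
  · simp at h
    obtain ⟨T, hT, rfl⟩ := h
    obtain ⟨Q, S, l', rfl, rfl⟩ := exists_of_encodeBlocks_eq_and_cons hT
    exact ⟨P, Q, _, l', rfl, by rw [hT]⟩
  · simp at h
    obtain ⟨T, hT, rfl⟩ := h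
    obtain ⟨Q, l', rfl, rfl⟩ := exists_of_encodeBlocks_eq_union_cons hT
    exact ⟨P, Q, _, l', rfl, by rw [hT]⟩

theorem exec_readName {P : BPattern} {o : Option (List (List Bool))} {l : List Block}
    (h : Exec readName (st [] X (encodeBlocks ((P, o) :: l)) Z) s') :
    ∃ m X', X = encodeTerm (.var m) ++ X' ∧ (∀ S, o = some S → m ∈ S) ∧
      s' = st [] X' (encodeBlocks ((P, o) :: l)) ((bits m).reverse ++ .var :: Z) := by
  rcases exec_add.1 h with h | h
  · rw [deadName, exec_seq_pop] at h
    obtain ⟨T, hT, h⟩ := h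
    obtain ⟨_, _, h0, -⟩ := exists_of_encodeBlocks_eq_union_cons hT
    simp at h0
    obtain ⟨⟨rfl, rfl⟩, rfl⟩ := h0
    simp [exec_seq_cons (L := loop _)] at h
    obtain ⟨X', rfl, hL⟩ := h
    obtain ⟨u, X', rfl, rfl⟩ := exec_recordBits hL
    exact ⟨u, X', rfl, by simp, by rw [← hT]; simp⟩
  · rw [liveName, exec_seq_pop] at h
    obtain ⟨T, hT, h⟩ := h
    obtain ⟨_, S, _, h0, rfl⟩ := exists_of_encodeBlocks_eq_and_cons hT
    simp at h0
    obtain ⟨⟨rfl, rfl⟩, rfl⟩ := h0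
    rw [exec_seq_cons] at h
    obtain ⟨_, h, h'⟩ := h
    rw [update_st_two] at h
    obtain ⟨S₁, S₂, rfl, rfl⟩ := exec_down (marked_encodeBlocks l) h
    rw [exec_seq_cons] at h'
    obtain ⟨_, h, h'⟩ := h'
    obtain ⟨u, T', hT', rfl⟩ := exec_downBits h
    simp [exec_seq_cons (L := loop _)] at h'
    obtain ⟨T', rfl, X', rfl, _, hL, h'⟩ := h'
    obtain ⟨S₂, rfl, rfl⟩ := exists_cons_of_encodeNames_append (marked_encodeBlocks l) hT'
    obtain ⟨m, A', X', hA, rfl, rfl⟩ := exec_compareBits hL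
    rw [exec_seq_cons] at h'
    obtain ⟨_, h, h'⟩ := h'
    obtain ⟨rfl, hA'⟩ := exec_up h
    rw [← List.map_reverse] at hA
    obtain ⟨hm, rfl⟩ := bits_append_inj (noBit_reverse_encodeNames S₁) hA' hA
    refine ⟨m, X', rfl, by simp [← hm], ?_⟩
    simp at h'
    rw [h', encodeBlocks_cons]
    simp [encodeBlock, encodeNames_append, encodeNames_cons, ← hm]

theorem exec_dropName {d : Option Bool} (h : Exec (dropName d) (st A X T Z) s') :
    ∃ u Z', u.head? = d ∧ Z = bits u ++ .var :: Z' ∧ s' = st A X T Z' := by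
  cases d with
  | none =>
    simp [dropName] at h
    obtain ⟨Z', rfl, rfl⟩ := h
    exact ⟨[], Z', rfl, rfl, rfl⟩
  | some b =>
    simp [dropName, exec_seq_cons (L := loop _)] at h
    obtain ⟨l, rfl, _, h, h'⟩ := h
    obtain ⟨u, Z', rfl, rfl⟩ := exec_dropBits h
    simp at h'
    obtain ⟨Z', rfl, rfl⟩ := h'
    exact ⟨b :: u, Z', rfl, rfl, rfl⟩

theorem exec_dropNames {d d₁ d₂ : Option Bool} (h : Exec (dropNames d d₁ d₂) (st A X T Z) s') :
    ∃ u v w Z', u.head? = d ∧ (w.head? = d₁ ∨ w.head? = d₂) ∧ v.length = A.length ∧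
      Z = bits u ++ .var :: (bits (v ++ w) ++ .var :: Z') ∧ s' = st [] X T Z' := by
  rw [dropNames, exec_seq_cons] at h
  obtain ⟨_, h, h'⟩ := h
  obtain ⟨u, Z', hu, rfl, rfl⟩ := exec_dropName h
  rw [exec_seq_cons] at h'
  obtain ⟨_, h, h'⟩ := h'
  obtain ⟨v, A', Z', rfl, hA, rfl⟩ := exec_countDownBits h
  rw [exec_seq_empty, exec_seq_cons] at h'
  obtain ⟨h0, _, h, h'⟩ := h'
  rw [exec_seq_nil] at h'
  subst h'
  rw [st_zero] at h0
  subst h0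
  rcases exec_add.1 h with h | h <;> obtain ⟨w, Z', hw, rfl, rfl⟩ := exec_dropName h
  · exact ⟨u, v, w, Z', hu, Or.inl hw, by simpa using hA.symm, by simp, rfl⟩
  · exact ⟨u, v, w, Z', hu, Or.inr hw, by simpa using hA.symm, by simp, rfl⟩

theorem exec_differ {x y : List Bool}
    (h : Exec differ (st [] X T ((bits y).reverse ++ .var :: ((bits x).reverse ++ .var :: Z))) s') :
    x ≠ y ∧ ∃ Z', s' = st [] X T Z' := by
  rw [differ, exec_seq_cons] at h
  obtain ⟨_, h, h'⟩ := h
  obtain ⟨p, Z₁, hZ₁, rfl⟩ := exec_countBits h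
  rw [exec_seq_cons] at h'
  obtain ⟨_, h, h'⟩ := h'
  rw [exec_seq_nil] at h'
  subst h'
  have H : ∃ d d₁ d₂, d₁ ≠ d ∧ d₂ ≠ d ∧
      Exec (dropNames d d₁ d₂) (st ((bits p).reverse ++ []) X T Z₁) s' := by
    rcases exec_add.1 h with h | h
    · rcases exec_add.1 h with h | h
      · exact ⟨_, _, _, by simp, by simp, h⟩
      · exact ⟨_, _, _, by simp, by simp, h⟩
    · exact ⟨_, _, _, by simp, by simp, h⟩
  obtain ⟨d, d₁, d₂, h₁, h₂, h⟩ := H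
  obtain ⟨u, v, w, Z', rfl, hw, hv, rfl, rfl⟩ := exec_dropNames h
  refine ⟨?_, Z', rfl⟩
  rintro rfl
  -- Both copies of the name agree with `p` up to the position compared, so their entries there
  -- are equal.
  rw [← List.append_assoc, ← List.map_append, ← List.map_reverse] at hZ₁
  obtain ⟨hpu, hZ₁⟩ := bits_append_inj (noBit_cons (by simp) _) (noBit_cons (by simp) _) hZ₁
  simp only [List.cons.injEq, true_and] at hZ₁
  obtain ⟨hvw, -⟩ := bits_append_inj (noBit_cons (by simp) _) (noBit_cons (by simp) _) hZ₁
  have := (List.append_inj (hpu.symm.trans hvw) (by simpa using hv.symm)).2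
  subst this
  rcases hw with hw | hw
  exacts [h₁ hw.symm, h₂ hw.symm]

theorem exec_skipPred (h : Exec (skipTerm .iri + skipTerm .var) (st A X T Z) s') :
    ∃ (p : PredTerm (List Bool) (List Bool)) (X' : List Sym),
      X = encodeTerm p.toPTerm ++ X' ∧ s' = st A X' T Z := by
  rcases exec_add.1 h with h | h <;> obtain ⟨u, X', rfl, rfl⟩ := exec_skipTerm h
  exacts [⟨.iri u, X', rfl, rfl⟩, ⟨.var u, X', rfl, rfl⟩]

theorem exec_skipConst (h : Exec (skipTerm .iri + skipTerm .lit) (st A X T Z) s') :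
    ∃ (c : Const (List Bool) (List Bool)) (X' : List Sym),
      X = encodeTerm c.toPTerm ++ X' ∧ s' = st A X' T Z := by
  rcases exec_add.1 h with h | h <;> obtain ⟨u, X', rfl, rfl⟩ := exec_skipTerm h
  exacts [⟨.iri u, X', rfl, rfl⟩, ⟨.lit u, X', rfl, rfl⟩]

theorem exec_skipAny
    (h : Exec (skipTerm .iri + skipTerm .lit + skipTerm .var) (st A X T Z) s') :
    ∃ (t : BTerm) (X' : List Sym), X = encodeTerm t ++ X' ∧ s' = st A X' T Z := by
  rcases exec_add.1 h with h | h
  · obtain ⟨c, X', h⟩ := exec_skipConst h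
    exact ⟨_, X', h⟩
  · obtain ⟨u, X', rfl, rfl⟩ := exec_skipTerm h
    exact ⟨.var u, X', rfl, rfl⟩

theorem exec_copyPred (h : Exec (skipTerm .iri + copyVar) (st A X T Z) s') :
    ∃ (p : PredTerm (List Bool) (List Bool)) (X' : List Sym), X = encodeTerm p.toPTerm ++ X' ∧
      s' = st A X' (encodeNames (p.toPTerm : BTerm).varList ++ T) Z := by
  rcases exec_add.1 h with h | h
  · obtain ⟨u, X', rfl, rfl⟩ := exec_skipTerm h
    exact ⟨.iri u, X', rfl, rfl⟩
  · obtain ⟨u, X', rfl, rfl⟩ := exec_copyVar h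
    exact ⟨.var u, X', rfl, rfl⟩

theorem exec_copyAny (h : Exec (skipTerm .iri + skipTerm .lit + copyVar) (st A X T Z) s') :
    ∃ (t : BTerm) (X' : List Sym), X = encodeTerm t ++ X' ∧
      s' = st A X' (encodeNames t.varList ++ T) Z := by
  rcases exec_add.1 h with h | h
  · obtain ⟨c, X', rfl, rfl⟩ := exec_skipConst h
    exact ⟨_, X', rfl, by cases c <;> rfl⟩
  · obtain ⟨u, X', rfl, rfl⟩ := exec_copyVar h
    exact ⟨.var u, X', rfl, rfl⟩

theorem exec_deadTriple (h : Exec deadTriple (st A X T Z) s') :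
    ∃ (P : BPattern) (X' : List Sym), (∀ F, P.InFragment F) ∧ X = encodePattern P ++ X' ∧
      s' = st A X' (.union :: T) Z := by
  simp only [deadTriple, exec_seq_cons (L := _ + _)] at h
  obtain ⟨_, h₁, _, h₂, _, h₃, h⟩ := h
  obtain ⟨u, X', rfl, rfl⟩ := exec_skipAny h₁
  obtain ⟨v, X', rfl, rfl⟩ := exec_skipPred h₂
  obtain ⟨w, X', rfl, rfl⟩ := exec_skipAny h₃
  simp at h
  obtain ⟨X', rfl, rfl⟩ := h
  exact ⟨.triple u v w, X', fun F => trivial, by simp [encodePattern], rfl⟩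

theorem exec_liveTriple (h : Exec liveTriple (st A X T Z) s') :
    ∃ (P : BPattern) (S : List (List Bool)) (X' : List Sym), (∀ F, P.InFragment F) ∧
      P.HasScheme S ∧ X = encodePattern P ++ X' ∧ s' = st A X' (.and :: encodeNames S ++ T) Z := by
  simp only [liveTriple, exec_seq_cons (L := _ + _)] at h
  obtain ⟨_, h₁, _, h₂, _, h₃, h⟩ := h
  obtain ⟨u, X', rfl, rfl⟩ := exec_copyPred h₁
  obtain ⟨v, X', rfl, rfl⟩ := exec_copyPred h₂
  obtain ⟨w, X', rfl, rfl⟩ := exec_copyAny h₃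
  simp at h
  obtain ⟨X', rfl, rfl⟩ := h
  refine ⟨.triple u.toPTerm v w, _, X', fun F => trivial, ⟨fun l => ?_, rfl⟩,
    by simp [encodePattern], by simp [encodeNames_append]⟩
  cases u <;> simp [PredTerm.toPTerm]

theorem not_exec_readName_nil : ¬ Exec readName (st A X [] Z) s' := by
  intro h
  rcases exec_add.1 h with h | h
  · simp [deadName] at h
  · simp [liveName] at h

theorem Block.Valid.filter {e : Bool} {P : BPattern} {o : Option (List (List Bool))}
    (h : Block.Valid e (P, o)) {C : BConstraint} (hC : C.cls ∈ fragment e)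
    (ho : ∀ S, o = some S → ∀ x ∈ C.varList, x ∈ S) : Block.Valid e (.filter P C, o) :=
  ⟨⟨h.1, hC⟩, fun S hS => ⟨h.2 S hS, ho S hS⟩⟩

/-- What a single execution of the main loop preserves. -/
theorem exec_step {e : Bool} {l : List Block} (hl : ∀ i ∈ l, Block.Valid e i)
    (h : Exec (step e) (st [] X (encodeBlocks l) Z) s') :
    ∃ l' X' Z', s' = st [] X' (encodeBlocks l') Z' ∧ (∀ i ∈ l', Block.Valid e i) ∧
      consumed l' ++ X' = consumed l ++ X := by
  simp only [step, exec_add] at h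
  rcases h with ((((((h | h) | h) | h) | h) | h) | h) | h
  · obtain ⟨P, X', hP, rfl, rfl⟩ := exec_deadTriple h
    exact ⟨(P, none) :: l, X', Z, rfl, List.forall_mem_cons.2 ⟨⟨hP _, by simp⟩, hl⟩,
      by simp [consumed]⟩
  · obtain ⟨P, S, X', hP, hS, rfl, rfl⟩ := exec_liveTriple h
    exact ⟨(P, some S) :: l, X', Z, rfl,
      List.forall_mem_cons.2 ⟨⟨hP _, fun S' hS' => by simp_all⟩, hl⟩, by simp [consumed]⟩
  · rw [unionStep, exec_seq_pop] at h
    obtain ⟨X', hX, h⟩ := h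
    rw [exec_seq_cons] at h
    obtain ⟨_, h, h'⟩ := h
    rw [exec_seq_nil] at h'
    subst h'
    rw [update_st_one] at h
    rcases exec_add.1 h with h | h
    · obtain ⟨P₂, P₁, o, l, rfl, rfl⟩ := exec_dropDead h
      simp only [List.forall_mem_cons] at hl
      exact ⟨(.union P₁ P₂, o) :: l, X', Z, rfl, List.forall_mem_cons.2
        ⟨⟨⟨hl.2.1.1, hl.1.1⟩, fun S hS => Or.inl (hl.2.1.2 S hS)⟩, hl.2.2⟩,
        by simp [consumed, encodePattern, ← hX]⟩
    · obtain ⟨P₂, S, l, T, rfl, hT, rfl⟩ := exec_joinBelow (Or.inr rfl) h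
      obtain ⟨P₁, l, rfl, rfl⟩ := exists_of_encodeBlocks_eq_union_cons hT
      simp only [List.forall_mem_cons] at hl
      exact ⟨(.union P₁ P₂, some S) :: l, X', Z, rfl, List.forall_mem_cons.2
        ⟨⟨⟨hl.2.1.1, hl.1.1⟩, fun S hS => Or.inr (hl.1.2 S hS)⟩, hl.2.2⟩,
        by simp [consumed, encodePattern, ← hX]⟩
  · rw [andStep, exec_seq_pop] at h
    obtain ⟨X', hX, h⟩ := h
    rw [exec_seq_cons] at h
    obtain ⟨_, h, h'⟩ := h
    rw [exec_seq_nil] at h'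
    subst h'
    rw [update_st_one] at h
    rcases exec_add.1 h with h | h
    · simp at h
      obtain ⟨T, hT, rfl⟩ := h
      obtain ⟨P₂, l, rfl, hT'⟩ := exists_of_encodeBlocks_eq_union_cons hT
      obtain ⟨P₁, l, rfl, rfl⟩ := exists_of_encodeBlocks_eq_union_cons hT'.symm
      simp only [List.forall_mem_cons] at hl
      exact ⟨(.and P₁ P₂, none) :: l, X', Z, rfl, List.forall_mem_cons.2
        ⟨⟨⟨hl.2.1.1, hl.1.1⟩, by simp⟩, hl.2.2⟩, by simp [consumed, encodePattern, ← hX]⟩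
    · obtain ⟨P₂, S₂, l, T, rfl, hT, rfl⟩ := exec_joinBelow (Or.inl rfl) h
      obtain ⟨P₁, S₁, l, rfl, rfl⟩ := exists_of_encodeBlocks_eq_and_cons hT
      simp only [List.forall_mem_cons] at hl
      refine ⟨(.and P₁ P₂, some (S₂ ++ S₁)) :: l, X', Z,
        by simp [encodeBlocks_cons, encodeBlock, encodeNames_append], List.forall_mem_cons.2
        ⟨⟨⟨hl.2.1.1, hl.1.1⟩, fun S hS => ?_⟩, hl.2.2⟩, by simp [consumed, encodePattern, ← hX]⟩
      exact ⟨S₁, S₂, hl.2.1.2 _ rfl, hl.1.2 _ rfl, (Option.some_injective _ hS).symm⟩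
  · rw [optStep, exec_seq_pop] at h
    obtain ⟨X', hX, h⟩ := h
    rw [exec_seq_cons] at h
    obtain ⟨_, h, h'⟩ := h
    rw [exec_seq_nil] at h'
    subst h'
    rw [update_st_one] at h
    rcases exec_add.1 h with h | h
    · obtain ⟨P₂, P₁, o, l, rfl, rfl⟩ := exec_dropDead h
      simp only [List.forall_mem_cons] at hl
      exact ⟨(.opt P₁ P₂, o) :: l, X', Z, rfl, List.forall_mem_cons.2
        ⟨⟨⟨hl.2.1.1, hl.1.1⟩, fun S hS => Or.inl (hl.2.1.2 S hS)⟩, hl.2.2⟩,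
        by simp [consumed, encodePattern, ← hX]⟩
    · obtain ⟨P₂, S₂, l, T, rfl, hT, rfl⟩ := exec_joinBelow (Or.inl rfl) h
      obtain ⟨P₁, S₁, l, rfl, rfl⟩ := exists_of_encodeBlocks_eq_and_cons hT
      simp only [List.forall_mem_cons] at hl
      refine ⟨(.opt P₁ P₂, some (S₂ ++ S₁)) :: l, X', Z,
        by simp [encodeBlocks_cons, encodeBlock, encodeNames_append], List.forall_mem_cons.2
        ⟨⟨⟨hl.2.1.1, hl.1.1⟩, fun S hS => ?_⟩, hl.2.2⟩, by simp [consumed, encodePattern, ← hX]⟩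
      exact Or.inr ⟨S₁, S₂, hl.2.1.2 _ rfl, hl.1.2 _ rfl, (Option.some_injective _ hS).symm⟩
  · rw [boundStep, exec_seq_cons] at h
    obtain ⟨_, h, h'⟩ := h
    rcases l with _ | ⟨⟨P, o⟩, l⟩
    · exact absurd h not_exec_readName_nil
    obtain ⟨x, X', rfl, hx, rfl⟩ := exec_readName h
    simp at h'
    obtain ⟨X', rfl, rfl⟩ := h'
    simp only [List.forall_mem_cons] at hl
    exact ⟨(.filter P (.bound x), o) :: l, X', _, rfl, List.forall_mem_cons.2
      ⟨hl.1.filter (by simp [fragment, Constraint.cls]) (by simpa [Constraint.varList] using hx),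
        hl.2⟩, by simp [consumed, encodePattern, encodeConstraint]⟩
  · rw [neConstStep, exec_seq_cons] at h
    obtain ⟨_, h, h'⟩ := h
    rcases l with _ | ⟨⟨P, o⟩, l⟩
    · exact absurd h not_exec_readName_nil
    obtain ⟨x, X', rfl, hx, rfl⟩ := exec_readName h
    rw [exec_seq_cons] at h'
    obtain ⟨_, h, h'⟩ := h'
    obtain ⟨c, X', rfl, rfl⟩ := exec_skipConst h
    simp at h'
    obtain ⟨X', rfl, rfl⟩ := h'
    simp only [List.forall_mem_cons] at hl
    exact ⟨(.filter P (.neConst x c), o) :: l, X', _, rfl, List.forall_mem_cons.2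
      ⟨hl.1.filter (by simp [fragment, Constraint.cls]) (by simpa [Constraint.varList] using hx),
        hl.2⟩, by simp [consumed, encodePattern, encodeConstraint]⟩
  · have h0 : ∃ Ls, cmpStep e = seq (readName :: readName :: Ls) := by
      cases e <;> exact ⟨_, rfl⟩
    obtain ⟨Ls, h0⟩ := h0
    have h0' := h
    rw [h0, exec_seq_cons] at h
    obtain ⟨_, h, -⟩ := h
    rcases l with _ | ⟨⟨P, o⟩, l⟩
    · exact absurd h not_exec_readName_nil
    clear h h0 Ls
    simp only [List.forall_mem_cons] at hl
    cases e with
    | true =>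
      simp only [cmpStep, exec_seq_cons (L := readName)] at h0'
      obtain ⟨_, h₁, _, h₂, h⟩ := h0'
      obtain ⟨x, X', rfl, hx, rfl⟩ := exec_readName h₁
      obtain ⟨y, X', rfl, hy, rfl⟩ := exec_readName h₂
      simp at h
      obtain ⟨X', rfl, rfl⟩ := h
      exact ⟨(.filter P (.eq x y), o) :: l, X', _, rfl, List.forall_mem_cons.2
        ⟨hl.1.filter (by simp [fragment, Constraint.cls, cmpClass]) (fun S hS => by
          simpa [Constraint.varList] using ⟨hx S hS, hy S hS⟩), hl.2⟩,
        by simp [consumed, encodePattern, encodeConstraint]⟩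
    | false =>
      simp only [cmpStep, exec_seq_cons (L := readName)] at h0'
      obtain ⟨_, h₁, _, h₂, h⟩ := h0'
      obtain ⟨x, X', rfl, hx, rfl⟩ := exec_readName h₁
      obtain ⟨y, X', rfl, hy, rfl⟩ := exec_readName h₂
      simp [exec_seq_cons (L := differ)] at h
      obtain ⟨X', rfl, h⟩ := h
      obtain ⟨hxy, Z', rfl⟩ := exec_differ (by simpa using h)
      exact ⟨(.filter P (.ne x y hxy), o) :: l, X', _, rfl, List.forall_mem_cons.2
        ⟨hl.1.filter (by simp [fragment, Constraint.cls, cmpClass]) (fun S hS => by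
          simpa [Constraint.varList] using ⟨hx S hS, hy S hS⟩), hl.2⟩,
        by simp [consumed, encodePattern, encodeConstraint]⟩

theorem exec_loadInput (h : Exec loadInput (st A X T Z) s') :
    s' = st [] (A.reverse ++ X) T Z := by
  rw [loadInput, exec_seq_cons] at h
  obtain ⟨_, h, h'⟩ := h
  obtain ⟨A', X', hA, rfl⟩ := Exec.kstar_induction
    (P := fun t => ∃ A' X', A.reverse ++ X = A'.reverse ++ X' ∧ t = st A' X' T Z) h
    ⟨A, X, rfl, rfl⟩ (by
      rintro _ t' ⟨A', X', hA, rfl⟩ h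
      obtain ⟨a, -, h⟩ := (exec_sum _ _).1 h
      simp at h
      obtain ⟨A', rfl, rfl⟩ := h
      exact ⟨A', a :: X', by simp [hA], rfl⟩)
  simp at h'
  obtain ⟨rfl, rfl⟩ := h'
  rw [hA]
  rfl

theorem initStore_eq (x : List Sym) : initStore x = st x.reverse [] [] [] := by
  funext k
  fin_cases k <;> rfl

/-- Every word accepted by the program is the code of a pattern with a scheme. -/
theorem exists_of_exec_program {e : Bool} {x : List Sym}
    (h : Exec (program e) (initStore x) s') :
    ∃ P : BPattern, encodePattern P = x ∧ P.InFragment (fragment e) ∧ ∃ S, P.HasScheme S := by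
  rw [initStore_eq, program, exec_seq_cons] at h
  obtain ⟨_, h, h'⟩ := h
  obtain rfl := exec_loadInput h
  rw [exec_seq_cons] at h'
  obtain ⟨_, h, h'⟩ := h'
  obtain ⟨l, X, Z, rfl, hl, hX⟩ := Exec.kstar_induction
    (P := fun t => ∃ l X Z, t = st [] X (encodeBlocks l) Z ∧ (∀ i ∈ l, Block.Valid e i) ∧
      consumed l ++ X = x) h ⟨[], x, [], by simp [encodeBlocks], by simp, rfl⟩ (by
    rintro _ t' ⟨l, X, Z, rfl, hl, hX⟩ h
    obtain ⟨l', X', Z', rfl, hl', hX'⟩ := exec_step hl h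
    exact ⟨l', X', Z', rfl, hl', hX'.trans hX⟩)
  rw [exec_seq_empty, exec_seq_pop] at h'
  obtain ⟨hX0, T, hT, h'⟩ := h'
  rw [exec_seq_cons] at h'
  obtain ⟨_, h, h'⟩ := h'
  rw [st_one] at hX0
  subst hX0
  obtain ⟨P, S, l, rfl, rfl⟩ := exists_of_encodeBlocks_eq_and_cons hT
  rw [update_st_two] at h
  obtain ⟨S₁, S₂, rfl, rfl⟩ := exec_down (marked_encodeBlocks l) h
  simp at h'
  obtain ⟨⟨-, hl0⟩, -⟩ := h'
  rcases l with _ | ⟨⟨Q, _ | S⟩, l⟩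
  · simp only [List.forall_mem_cons] at hl
    exact ⟨P, by simpa [consumed] using hX, hl.1.1, _, hl.1.2 _ rfl⟩
  · simp [encodeBlocks, encodeBlock] at hl0
  · simp [encodeBlocks, encodeBlock] at hl0

end SPARQL

/-! ### Completeness of the program -/

namespace SPARQL

open StackProgram
open scoped Computability

variable {A X T Z : List Sym} {s t s' : Fin 4 → List Sym} {Ls : List Prog} {n c : ℕ}

section Actions

variable {a : Sym}

theorem runs_push_aux (h : Runs (seq Ls) n (st (a :: A) X T Z) s') :
    Runs (seq (push 0 a :: Ls)) (1 + n) (st A X T Z) s' :=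
  (Exec.runs_of_singleton (exec_push.2 (by simp))).seq_cons h

theorem runs_push_input (h : Runs (seq Ls) n (st A (a :: X) T Z) s') :
    Runs (seq (push 1 a :: Ls)) (1 + n) (st A X T Z) s' :=
  (Exec.runs_of_singleton (exec_push.2 (by simp))).seq_cons h

theorem runs_push_main (h : Runs (seq Ls) n (st A X (a :: T) Z) s') :
    Runs (seq (push 2 a :: Ls)) (1 + n) (st A X T Z) s' :=
  (Exec.runs_of_singleton (exec_push.2 (by simp))).seq_cons h

theorem runs_push_names (h : Runs (seq Ls) n (st A X T (a :: Z)) s') :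
    Runs (seq (push 3 a :: Ls)) (1 + n) (st A X T Z) s' :=
  (Exec.runs_of_singleton (exec_push.2 (by simp))).seq_cons h

theorem runs_pop_aux (h : Runs (seq Ls) n (st A X T Z) s') :
    Runs (seq (pop 0 a :: Ls)) (1 + n) (st (a :: A) X T Z) s' :=
  (Exec.runs_of_singleton (exec_pop.2 (by simp))).seq_cons h

theorem runs_pop_input (h : Runs (seq Ls) n (st A X T Z) s') :
    Runs (seq (pop 1 a :: Ls)) (1 + n) (st A (a :: X) T Z) s' :=
  (Exec.runs_of_singleton (exec_pop.2 (by simp))).seq_cons h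

theorem runs_pop_main (h : Runs (seq Ls) n (st A X T Z) s') :
    Runs (seq (pop 2 a :: Ls)) (1 + n) (st A X (a :: T) Z) s' :=
  (Exec.runs_of_singleton (exec_pop.2 (by simp))).seq_cons h

theorem runs_pop_names (h : Runs (seq Ls) n (st A X T Z) s') :
    Runs (seq (pop 3 a :: Ls)) (1 + n) (st A X T (a :: Z)) s' :=
  (Exec.runs_of_singleton (exec_pop.2 (by simp))).seq_cons h

theorem runs_empty_aux (h : Runs (seq Ls) n (st [] X T Z) s') :
    Runs (seq (empty 0 :: Ls)) (1 + n) (st [] X T Z) s' :=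
  (Exec.runs_of_singleton (exec_empty.2 (by simp))).seq_cons h

theorem runs_empty_input (h : Runs (seq Ls) n (st A [] T Z) s') :
    Runs (seq (empty 1 :: Ls)) (1 + n) (st A [] T Z) s' :=
  (Exec.runs_of_singleton (exec_empty.2 (by simp))).seq_cons h

theorem runs_empty_main (h : Runs (seq Ls) n (st A X [] Z) s') :
    Runs (seq (empty 2 :: Ls)) (1 + n) (st A X [] Z) s' :=
  (Exec.runs_of_singleton (exec_empty.2 (by simp))).seq_cons h

end Actions

theorem runs_seq_single {L : Prog} (h : Runs L n s s') : Runs (seq [L]) n s s' :=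
  h.seq_cons (.seq_nil _)

theorem runs_loop_nil (f : Bool → List Prog) (s : Fin 4 → List Sym) : Runs (loop f) 0 s s :=
  .kstar_nil _ s

theorem runs_loop_cons {f : Bool → List Prog} (b : Bool) (h : Runs (seq (f b)) c s t)
    (h' : Runs (loop f) n t s') : Runs (loop f) (c + n) s s' := by
  refine Runs.kstar_cons ?_ h'
  cases b
  exacts [h.add_left, h.add_right]

theorem runs_skipBits (u : List Bool) :
    Runs skipBits u.length (st A (bits u ++ X) T Z) (st A X T Z) := by
  induction u with
  | nil => exact runs_loop_nil _ _
  | cons b u ih =>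
    exact (runs_loop_cons b (runs_pop_input (.seq_nil _)) ih).mono (by simp; omega)

theorem runs_copyBits (u : List Bool) :
    Runs (loop fun b => [pop 1 (.bit b), push 2 (.bit b)]) (2 * u.length)
      (st A (bits u ++ X) T Z) (st A X ((bits u).reverse ++ T) Z) := by
  induction u generalizing T with
  | nil => exact runs_loop_nil _ _
  | cons b u ih =>
    have := ih (T := .bit b :: T)
    rw [show (bits (b :: u)).reverse ++ T = (bits u).reverse ++ .bit b :: T by simp]
    exact (runs_loop_cons b (runs_pop_input (runs_push_main (.seq_nil _))) this).mono
      (by simp; omega)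

theorem runs_recordBits (u : List Bool) :
    Runs (loop fun b => [pop 1 (.bit b), push 3 (.bit b)]) (2 * u.length)
      (st A (bits u ++ X) T Z) (st A X T ((bits u).reverse ++ Z)) := by
  induction u generalizing Z with
  | nil => exact runs_loop_nil _ _
  | cons b u ih =>
    have := ih (Z := .bit b :: Z)
    rw [show (bits (b :: u)).reverse ++ Z = (bits u).reverse ++ .bit b :: Z by simp]
    exact (runs_loop_cons b (runs_pop_input (runs_push_names (.seq_nil _))) this).mono
      (by simp; omega)

theorem runs_downBits (u : List Bool) :
    Runs downBits (2 * u.length) (st A X (bits u ++ T) Z) (st ((bits u).reverse ++ A) X T Z) := by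
  induction u generalizing A with
  | nil => exact runs_loop_nil _ _
  | cons b u ih =>
    have := ih (A := .bit b :: A)
    rw [show (bits (b :: u)).reverse ++ A = (bits u).reverse ++ .bit b :: A by simp]
    exact (runs_loop_cons b (runs_pop_main (runs_push_aux (.seq_nil _))) this).mono
      (by simp; omega)

theorem runs_upBits (u : List Bool) :
    Runs (loop fun b => [pop 0 (.bit b), push 2 (.bit b)]) (2 * u.length)
      (st (bits u ++ A) X T Z) (st A X ((bits u).reverse ++ T) Z) := by
  induction u generalizing T with
  | nil => exact runs_loop_nil _ _
  | cons b u ih =>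
    have := ih (T := .bit b :: T)
    rw [show (bits (b :: u)).reverse ++ T = (bits u).reverse ++ .bit b :: T by simp]
    exact (runs_loop_cons b (runs_pop_aux (runs_push_main (.seq_nil _))) this).mono
      (by simp; omega)

theorem runs_compareBits (u : List Bool) :
    Runs (loop fun b => [pop 0 (.bit b), pop 1 (.bit b), push 2 (.bit b), push 3 (.bit b)])
      (4 * u.length) (st (bits u ++ A) (bits u ++ X) T Z)
      (st A X ((bits u).reverse ++ T) ((bits u).reverse ++ Z)) := by
  induction u generalizing T Z with
  | nil => exact runs_loop_nil _ _
  | cons b u ih =>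
    have := ih (T := .bit b :: T) (Z := .bit b :: Z)
    rw [show (bits (b :: u)).reverse ++ T = (bits u).reverse ++ .bit b :: T by simp,
      show (bits (b :: u)).reverse ++ Z = (bits u).reverse ++ .bit b :: Z by simp]
    exact (runs_loop_cons b (runs_pop_aux (runs_pop_input (runs_push_main
      (runs_push_names (.seq_nil _))))) this).mono (by simp; omega)

theorem runs_countBits (u : List Bool) :
    Runs (loop fun b => [pop 3 (.bit b), push 0 (.bit b)]) (2 * u.length)
      (st A X T (bits u ++ Z)) (st ((bits u).reverse ++ A) X T Z) := by
  induction u generalizing A with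
  | nil => exact runs_loop_nil _ _
  | cons b u ih =>
    have := ih (A := .bit b :: A)
    rw [show (bits (b :: u)).reverse ++ A = (bits u).reverse ++ .bit b :: A by simp]
    exact (runs_loop_cons b (runs_pop_names (runs_push_aux (.seq_nil _))) this).mono
      (by simp; omega)

theorem runs_countDownBits (u v : List Bool) (h : v.length = u.length) :
    Runs (loop fun b => [pop 3 (.bit b), pop 0 (.bit false) + pop 0 (.bit true)])
      (2 * u.length) (st (bits v) X T (bits u ++ Z)) (st [] X T Z) := by
  induction u generalizing v with
  | nil =>
    obtain rfl := List.length_eq_zero_iff.1 h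
    exact runs_loop_nil _ _
  | cons b u ih =>
    rcases v with _ | ⟨a, v⟩
    · simp at h
    refine (runs_loop_cons (c := 2) b (runs_pop_names (n := 1) (runs_seq_single ?_))
      (ih v (by simpa using h))).mono (by simp; omega)
    have := Exec.runs_of_singleton
      (exec_pop (k := 0) (a := .bit a) (s := st (bits (a :: v)) X T (bits u ++ Z))
        (s' := st (bits v) X T (bits u ++ Z)) |>.2 (by simp))
    cases a
    exacts [this.add_left, this.add_right]

theorem runs_dropBits (u : List Bool) :
    Runs (loop fun b => [pop 3 (.bit b)]) u.length (st A X T (bits u ++ Z)) (st A X T Z) := by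
  induction u with
  | nil => exact runs_loop_nil _ _
  | cons b u ih =>
    exact (runs_loop_cons b (runs_pop_names (.seq_nil _)) ih).mono (by simp; omega)

theorem runs_skipTerm (a : Sym) (u : List Bool) :
    Runs (skipTerm a) (1 + u.length) (st A (a :: bits u ++ X) T Z) (st A X T Z) :=
  runs_pop_input (runs_seq_single (runs_skipBits u))

theorem runs_copyVar (u : List Bool) :
    Runs copyVar (2 + 2 * u.length) (st A (encodeTerm (.var u) ++ X) T Z)
      (st A X (encodeNames [u] ++ T) Z) := by
  have := runs_copyBits (A := A) (X := X) (T := .var :: T) (Z := Z) u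
  rw [show encodeNames [u] ++ T = (bits u).reverse ++ .var :: T by simp [encodeNames]]
  exact (runs_pop_input (runs_push_main (runs_seq_single this))).mono (by omega)

theorem runs_down (S : List (List Bool)) :
    Runs down (2 * (encodeNames S).length) (st A X (encodeNames S ++ T) Z)
      (st ((encodeNames S).reverse ++ A) X T Z) := by
  induction S generalizing A with
  | nil => exact .kstar_nil _ _
  | cons m S ih =>
    have := ih (A := .var :: (bits m ++ A))
    rw [show (encodeNames (m :: S)).reverse ++ A =
        (encodeNames S).reverse ++ .var :: (bits m ++ A) by simp [encodeNames_cons],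
      encodeNames_cons, List.append_assoc, ← List.map_reverse]
    have h := (runs_downBits (A := A) (X := X) (T := .var :: (encodeNames S ++ T)) (Z := Z)
      m.reverse).seq_cons (runs_pop_main (runs_push_aux (a := .var) (.seq_nil _)))
    rw [← List.map_reverse, List.reverse_reverse] at h
    exact (h.kstar_cons this).mono (by simp; omega)

theorem runs_up (S : List (List Bool)) :
    Runs up (2 * (encodeNames S).length + 1) (st (encodeNames S).reverse X T Z)
      (st [] X (encodeNames S ++ T) Z) := by
  refine (Runs.seq_cons (t := st [] X (encodeNames S ++ T) Z) (n := 2 * (encodeNames S).length)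
    ?_ (runs_empty_aux (.seq_nil _))).mono (by omega)
  induction S using List.reverseRecOn generalizing T with
  | nil => exact .kstar_nil _ _
  | append_singleton S m ih =>
    have := ih (T := (bits m).reverse ++ .var :: T)
    rw [show (encodeNames (S ++ [m])).reverse = .var :: (bits m ++ (encodeNames S).reverse) by
        simp [encodeNames],
      show encodeNames (S ++ [m]) ++ T = encodeNames S ++ ((bits m).reverse ++ .var :: T) by
        simp [encodeNames]]
    exact (Runs.kstar_cons (runs_pop_aux (runs_push_main (runs_seq_single (runs_upBits m))))
      this).mono (by simp [encodeNames]; omega)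

theorem runs_joinBelow (a : Sym) (S : List (List Bool)) :
    Runs (joinBelow a) (4 * (encodeNames S).length + 4)
      (st [] X (.and :: (encodeNames S ++ a :: T)) Z) (st [] X (.and :: (encodeNames S ++ T)) Z) := by
  have h := runs_down (A := []) (X := X) (T := a :: T) (Z := Z) S
  rw [List.append_nil] at h
  exact (runs_pop_main (h.seq_cons (runs_pop_main ((runs_up S).seq_cons
    (runs_push_main (.seq_nil _)))))).mono (by omega)

theorem runs_dropDead (o : Option (List (List Bool))) :
    Runs dropDead 3 (st [] X (.union :: (encodeBlock o ++ T)) Z)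
      (st [] X (encodeBlock o ++ T) Z) := by
  refine (runs_pop_main (n := 2) (runs_seq_single ?_)).mono (by omega)
  cases o with
  | none => exact Runs.add_right (runs_pop_main (runs_push_main (.seq_nil _)))
  | some S => exact Runs.add_left (runs_pop_main (runs_push_main (.seq_nil _)))

theorem runs_readName (x : List Bool) (o : Option (List (List Bool)))
    (ho : ∀ S, o = some S → x ∈ S) :
    Runs readName (4 * (encodeBlock o).length + 6 * x.length + 7)
      (st [] (encodeTerm (.var x) ++ X) (encodeBlock o ++ T) Z)
      (st [] X (encodeBlock o ++ T) ((bits x).reverse ++ .var :: Z)) := by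
  cases o with
  | none =>
    exact Runs.add_left ((runs_pop_main (runs_push_main (runs_pop_input (runs_push_names
      (runs_seq_single (runs_recordBits x)))))).mono (by omega))
  | some S =>
    obtain ⟨S₁, S₂, rfl⟩ := List.append_of_mem (ho S rfl)
    refine Runs.add_right ?_
    have h₁ := runs_down (A := []) (X := encodeTerm (.var x) ++ X)
      (T := encodeNames (x :: S₂) ++ T) (Z := Z) S₁
    have h₂ := runs_downBits (A := (encodeNames S₁).reverse ++ [])
      (X := encodeTerm (.var x) ++ X) (T := .var :: (encodeNames S₂ ++ T)) (Z := Z) x.reverse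
    rw [← List.map_reverse, List.reverse_reverse, List.append_nil] at h₂
    rw [List.append_nil] at h₁
    have h₃ := runs_compareBits (A := (encodeNames S₁).reverse) (X := X)
      (T := .var :: (encodeNames S₂ ++ T)) (Z := .var :: Z) x
    have h₄ := runs_up (X := X) (T := (bits x).reverse ++ .var :: (encodeNames S₂ ++ T))
      (Z := (bits x).reverse ++ .var :: Z) S₁
    have h₅ : encodeNames (x :: S₂) ++ T =
        bits x.reverse ++ .var :: (encodeNames S₂ ++ T) := by
      simp [encodeNames_cons]
    have h₆ : (bits x).reverse ++ .var :: (encodeNames S₂ ++ T) = encodeNames (x :: S₂) ++ T := by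
      simp [encodeNames_cons]
    rw [h₅] at h₁
    rw [h₆] at h₄
    have h := runs_pop_main (a := .and) (h₁.seq_cons (h₂.seq_cons (runs_pop_main (runs_push_main
      (runs_pop_input (runs_push_names (h₃.seq_cons (by
        rw [h₆]; exact h₄.seq_cons (runs_push_main (a := .and) (.seq_nil _))))))))))
    rw [← h₅, ← List.append_assoc, ← encodeNames_append] at h
    exact h.mono (by simp [encodeBlock, encodeNames_append]; omega)

theorem runs_dropName (u : List Bool) :
    Runs (dropName u.head?) (u.length + 1) (st A X T (bits u ++ .var :: Z)) (st A X T Z) := by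
  cases u with
  | nil => exact runs_pop_names (.seq_nil _)
  | cons b u =>
    exact (runs_pop_names ((runs_dropBits u).seq_cons (runs_pop_names (.seq_nil _)))).mono
      (by simp; omega)

theorem exists_first_difference {α : Type*} {x y : List α} (h : x ≠ y) :
    ∃ p u w, x = p ++ u ∧ y = p ++ w ∧ u.head? ≠ w.head? := by
  induction x generalizing y with
  | nil =>
    rcases y with _ | ⟨b, y⟩
    · exact absurd rfl h
    · exact ⟨[], [], b :: y, rfl, rfl, by simp⟩
  | cons a x ih =>
    rcases y with _ | ⟨b, y⟩
    · exact ⟨[], a :: x, [], rfl, rfl, by simp⟩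
    · by_cases hab : a = b
      · subst hab
        obtain ⟨p, u, w, rfl, rfl, hd⟩ := ih (y := y) (by simpa using h)
        exact ⟨a :: p, u, w, rfl, rfl, hd⟩
      · exact ⟨[], a :: x, b :: y, rfl, rfl, by simpa using hab⟩

theorem runs_dropNames (p u w : List Bool) {d₁ d₂ : Option Bool}
    (hw : w.head? = d₁ ∨ w.head? = d₂) :
    Runs (dropNames u.head? d₁ d₂) (2 * p.length + u.length + w.length + 3)
      (st (bits p.reverse) X T (bits u ++ .var :: (bits (p ++ w) ++ .var :: Z)))
      (st [] X T Z) := by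
  have h : Runs (dropName d₁ + dropName d₂) (w.length + 1)
      (st [] X T (bits w ++ .var :: Z)) (st [] X T Z) := by
    rcases hw with rfl | rfl
    exacts [(runs_dropName w).add_left, (runs_dropName w).add_right]
  rw [show bits (p ++ w) = bits p ++ bits w from List.map_append, List.append_assoc]
  exact ((runs_dropName u).seq_cons ((runs_countDownBits p p.reverse (by simp)).seq_cons
    (runs_empty_aux (runs_seq_single h)))).mono (by omega)

/-- The number of bits to be moved is that of the longest common suffix of the names. -/
theorem runs_differ {x y : List Bool} (h : x ≠ y) :
    Runs differ (4 * x.length + 4 * y.length + 3)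
      (st [] X T ((bits y).reverse ++ .var :: ((bits x).reverse ++ .var :: Z)))
      (st [] X T Z) := by
  obtain ⟨p, u, w, hy, hx, hd⟩ := exists_first_difference (x := y.reverse) (y := x.reverse)
    fun h' => h (List.reverse_injective h').symm
  have hyl := congrArg List.length hy
  have hxl := congrArg List.length hx
  simp only [List.length_reverse, List.length_append] at hyl hxl
  rw [← List.map_reverse, ← List.map_reverse, hx, hy, List.map_append, List.append_assoc]
  refine ((runs_countBits p).seq_cons (runs_seq_single
    (n := 2 * p.length + u.length + w.length + 3) ?_)).mono (by omega)
  rw [List.append_nil, ← List.map_reverse]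
  rcases hu : u.head? with _ | _ | _
  · refine Runs.add_left (Runs.add_left (hu ▸ runs_dropNames p u w ?_))
    rw [hu] at hd
    rcases hw : w.head? with _ | _ | _ <;> simp_all
  · refine Runs.add_left (Runs.add_right (hu ▸ runs_dropNames p u w ?_))
    rw [hu] at hd
    rcases hw : w.head? with _ | _ | _ <;> simp_all
  · refine Runs.add_right (hu ▸ runs_dropNames p u w ?_)
    rw [hu] at hd
    rcases hw : w.head? with _ | _ | _ <;> simp_all

/-! ### Length of the executions -/

theorem runs_skipPred (p : PredTerm (List Bool) (List Bool)) :
    Runs (skipTerm .iri + skipTerm .var) (encodeTerm (p.toPTerm : BTerm)).length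
      (st A (encodeTerm p.toPTerm ++ X) T Z) (st A X T Z) := by
  cases p with
  | iri u => exact (runs_skipTerm _ u).add_left.mono (by simp [encodeTerm, PredTerm.toPTerm]; omega)
  | var u => exact (runs_skipTerm _ u).add_right.mono (by simp [encodeTerm, PredTerm.toPTerm]; omega)

theorem runs_skipConst (c : Const (List Bool) (List Bool)) :
    Runs (skipTerm .iri + skipTerm .lit) (encodeTerm (c.toPTerm : BTerm)).length
      (st A (encodeTerm c.toPTerm ++ X) T Z) (st A X T Z) := by
  cases c with
  | iri u => exact (runs_skipTerm _ u).add_left.mono (by simp [encodeTerm, Const.toPTerm]; omega)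
  | lit u => exact (runs_skipTerm _ u).add_right.mono (by simp [encodeTerm, Const.toPTerm]; omega)

theorem runs_skipAny (t : BTerm) :
    Runs (skipTerm .iri + skipTerm .lit + skipTerm .var) (encodeTerm t).length
      (st A (encodeTerm t ++ X) T Z) (st A X T Z) := by
  cases t with
  | iri u => exact (runs_skipConst (.iri u)).add_left
  | lit u => exact (runs_skipConst (.lit u)).add_left
  | var u => exact (runs_skipTerm _ u).add_right.mono (by simp [encodeTerm]; omega)

theorem runs_copyPred (p : PredTerm (List Bool) (List Bool)) :
    Runs (skipTerm .iri + copyVar) (2 * (encodeTerm (p.toPTerm : BTerm)).length)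
      (st A (encodeTerm p.toPTerm ++ X) T Z)
      (st A X (encodeNames (p.toPTerm : BTerm).varList ++ T) Z) := by
  cases p with
  | iri u => exact (runs_skipTerm _ u).add_left.mono (by simp [encodeTerm, PredTerm.toPTerm]; omega)
  | var u => exact (runs_copyVar u).add_right.mono (by simp [encodeTerm, PredTerm.toPTerm]; omega)

theorem runs_copyAny (t : BTerm) :
    Runs (skipTerm .iri + skipTerm .lit + copyVar) (2 * (encodeTerm t).length)
      (st A (encodeTerm t ++ X) T Z) (st A X (encodeNames t.varList ++ T) Z) := by
  cases t with
  | iri u => exact (runs_skipConst (.iri u)).add_left.mono (by simp [Const.toPTerm]; omega)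
  | lit u => exact (runs_skipConst (.lit u)).add_left.mono (by simp [Const.toPTerm]; omega)
  | var u => exact (runs_copyVar u).add_right.mono (by simp [encodeTerm]; omega)

theorem length_encodeNames_varList (t : BTerm) :
    (encodeNames t.varList).length ≤ (encodeTerm t).length := by
  cases t <;> simp [encodeNames, PTerm.varList, encodeTerm]

/-- Schemes are not longer than patterns. -/
theorem Pattern.HasScheme.length_le {P : BPattern} {S : List (List Bool)} (h : P.HasScheme S) :
    (encodeNames S).length + 1 ≤ (encodePattern P).length := by
  induction P generalizing S with
  | triple u v w =>
    obtain ⟨-, rfl⟩ := h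
    have hu := length_encodeNames_varList u
    have hv := length_encodeNames_varList v.toPTerm
    have hw := length_encodeNames_varList w
    simp only [encodeNames_append, encodePattern, List.length_append, List.length_singleton]
    omega
  | union P₁ P₂ h₁ h₂ =>
    simp only [encodePattern, List.length_append, List.length_singleton]
    rcases h with h | h
    · have := h₁ h; omega
    · have := h₂ h; omega
  | and P₁ P₂ h₁ h₂ =>
    obtain ⟨S₁, S₂, hS₁, hS₂, rfl⟩ := h
    have := h₁ hS₁
    have := h₂ hS₂
    simp only [encodeNames_append, encodePattern, List.length_append, List.length_singleton]
    omega
  | opt P₁ P₂ h₁ h₂ =>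
    rcases h with h | ⟨S₁, S₂, hS₁, hS₂, rfl⟩
    · have := h₁ h
      simp only [encodePattern, List.length_append, List.length_singleton]
      omega
    · have := h₁ hS₁
      have := h₂ hS₂
      simp only [encodeNames_append, encodePattern, List.length_append, List.length_singleton]
      omega
  | filter P C h' =>
    have := h' h.1
    simp only [encodePattern, List.length_append]
    omega

theorem length_encodePattern_pos (P : BPattern) : 1 ≤ (encodePattern P).length := by
  induction P with
  | filter P C h => simp only [encodePattern, List.length_append]; omega
  | _ => simp [encodePattern]; omega

theorem length_encodeBlock_le {P : BPattern} {o : Option (List (List Bool))}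
    (h : ∀ S, o = some S → P.HasScheme S) :
    (encodeBlock o).length ≤ (encodePattern P).length := by
  cases o with
  | none => exact length_encodePattern_pos P
  | some S => exact (h S rfl).length_le

theorem runs_triple (u : BTerm) (v : PredTerm (List Bool) (List Bool)) (w : BTerm)
    (o : Option (List (List Bool)))
    (ho : ∀ S, o = some S → (Pattern.triple u v w).HasScheme S) :
    Runs (deadTriple + liveTriple) (2 * (encodePattern (.triple u v w)).length)
      (st [] (encodePattern (.triple u v w) ++ X) T Z) (st [] X (encodeBlock o ++ T) Z) := by
  simp only [encodePattern, List.append_assoc, List.length_append, List.length_singleton]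
  cases o with
  | none =>
    exact Runs.add_left (((runs_skipAny u).seq_cons ((runs_skipPred v).seq_cons
      ((runs_skipAny w).seq_cons (runs_pop_input (runs_push_main (.seq_nil _)))))).mono (by omega))
  | some S =>
    obtain ⟨hu, rfl⟩ := ho S rfl
    refine Runs.add_right ?_
    obtain ⟨u, rfl⟩ : ∃ p : PredTerm (List Bool) (List Bool), u = p.toPTerm := by
      cases u with
      | iri u => exact ⟨.iri u, rfl⟩
      | lit u => exact absurd rfl (hu u)
      | var u => exact ⟨.var u, rfl⟩
    simp only [encodeBlock, encodeNames_append, List.cons_append, List.nil_append,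
      List.append_assoc]
    exact ((runs_copyPred u).seq_cons ((runs_copyPred v).seq_cons
      ((runs_copyAny w).seq_cons (runs_pop_input (runs_push_main (.seq_nil _)))))).mono (by omega)

theorem runs_unionStep {o₁ o₂ o : Option (List (List Bool))}
    (h : (o = o₁ ∧ o₂ = none) ∨ (o = o₂ ∧ o₂ ≠ none ∧ o₁ = none)) :
    Runs unionStep (4 * (encodeBlock o₂).length + 4)
      (st [] (.union :: X) (encodeBlock o₂ ++ (encodeBlock o₁ ++ T)) Z)
      (st [] X (encodeBlock o ++ T) Z) := by
  rcases h with ⟨rfl, rfl⟩ | ⟨rfl, h, rfl⟩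
  · exact (runs_pop_input (runs_seq_single (runs_dropDead o).add_left)).mono (by omega)
  · cases o with
    | none => exact absurd rfl h
    | some S =>
      have := runs_joinBelow (X := X) (T := T) (Z := Z) .union S
      exact (runs_pop_input (runs_seq_single (Runs.add_right (by
        simpa [encodeBlock] using this)))).mono (by simp [encodeBlock]; omega)

theorem runs_joinBelow_and (S₁ S₂ : List (List Bool)) :
    Runs (joinBelow .and) (4 * (encodeBlock (some S₂)).length)
      (st [] X (encodeBlock (some S₂) ++ (encodeBlock (some S₁) ++ T)) Z)
      (st [] X (encodeBlock (some (S₂ ++ S₁)) ++ T) Z) := by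
  have := runs_joinBelow (X := X) (T := encodeNames S₁ ++ T) (Z := Z) .and S₂
  refine Runs.mono (n := 4 * (encodeNames S₂).length + 4) ?_ (by simp [encodeBlock]; omega)
  simpa [encodeBlock, encodeNames_append] using this

theorem runs_andStep {o₁ o₂ o : Option (List (List Bool))}
    (h : (o = none ∧ o₁ = none ∧ o₂ = none) ∨
      ∃ S₁ S₂, o₁ = some S₁ ∧ o₂ = some S₂ ∧ o = some (S₂ ++ S₁)) :
    Runs andStep (4 * (encodeBlock o₂).length + 4)
      (st [] (.and :: X) (encodeBlock o₂ ++ (encodeBlock o₁ ++ T)) Z)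
      (st [] X (encodeBlock o ++ T) Z) := by
  rcases h with ⟨rfl, rfl, rfl⟩ | ⟨S₁, S₂, rfl, rfl, rfl⟩
  · exact (runs_pop_input (runs_seq_single (Runs.add_left (runs_pop_main (runs_pop_main
      (runs_push_main (.seq_nil _))))))).mono (by omega)
  · exact (runs_pop_input (runs_seq_single (runs_joinBelow_and S₁ S₂).add_right)).mono (by omega)

theorem runs_optStep {o₁ o₂ o : Option (List (List Bool))}
    (h : (o = o₁ ∧ o₂ = none) ∨
      ∃ S₁ S₂, o₁ = some S₁ ∧ o₂ = some S₂ ∧ o = some (S₂ ++ S₁)) :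
    Runs optStep (4 * (encodeBlock o₂).length + 4)
      (st [] (.opt :: X) (encodeBlock o₂ ++ (encodeBlock o₁ ++ T)) Z)
      (st [] X (encodeBlock o ++ T) Z) := by
  rcases h with ⟨rfl, rfl⟩ | ⟨S₁, S₂, rfl, rfl, rfl⟩
  · exact (runs_pop_input (runs_seq_single (runs_dropDead o).add_left)).mono (by omega)
  · exact (runs_pop_input (runs_seq_single (runs_joinBelow_and S₁ S₂).add_right)).mono (by omega)

theorem runs_step {e : Bool} {L : Prog} (h : Runs L n s s')
    (hL : L ∈ [deadTriple + liveTriple, unionStep, andStep, optStep, boundStep, neConstStep,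
      cmpStep e]) : Runs (step e) n s s' := by
  simp only [List.mem_cons, List.not_mem_nil, or_false] at hL
  unfold step
  rcases hL with rfl | rfl | rfl | rfl | rfl | rfl | rfl
  · exact h.add_left.add_left.add_left.add_left.add_left.add_left
  · exact h.add_right.add_left.add_left.add_left.add_left.add_left
  · exact h.add_right.add_left.add_left.add_left.add_left
  · exact h.add_right.add_left.add_left.add_left
  · exact h.add_right.add_left.add_left
  · exact h.add_right.add_left
  · exact h.add_right

theorem runs_filter {e : Bool} {C : BConstraint} (hC : C.cls ∈ fragment e)
    (o : Option (List (List Bool))) (ho : ∀ S, o = some S → ∀ x ∈ C.varList, x ∈ S) :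
    ∃ Z', Runs (step e) (8 * (encodeBlock o).length + 11 * (encodeConstraint C).length)
      (st [] (encodeConstraint C ++ X) (encodeBlock o ++ T) Z)
      (st [] X (encodeBlock o ++ T) Z') := by
  cases C with
  | bound x =>
    refine ⟨(bits x).reverse ++ .var :: Z, runs_step (L := boundStep) ?_ (by simp)⟩
    have h := runs_readName (X := .bound :: X) (T := T) (Z := Z) x o
      fun S hS => ho S hS x (by simp [Constraint.varList])
    simp only [encodeConstraint, List.append_assoc, List.cons_append, List.nil_append]
    refine (h.seq_cons (runs_pop_input (.seq_nil _))).mono ?_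
    simp only [encodeTerm, List.length_append, List.length_cons, List.length_map, List.length_nil]
    omega
  | notBound x => exact absurd hC (notBound_notMem_fragment e)
  | eqConst x c => cases e <;> simp [fragment, cmpClass, Constraint.cls] at hC
  | neConst x c =>
    refine ⟨(bits x).reverse ++ .var :: Z, runs_step (L := neConstStep) ?_ (by simp)⟩
    have h := runs_readName (X := encodeTerm c.toPTerm ++ .neConst :: X) (T := T) (Z := Z) x o
      fun S hS => ho S hS x (by simp [Constraint.varList])
    simp only [encodeConstraint, List.append_assoc, List.cons_append, List.nil_append]
    refine (h.seq_cons ((runs_skipConst c).seq_cons (runs_pop_input (.seq_nil _)))).mono ?_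
    simp only [encodeTerm, List.length_append, List.length_cons, List.length_map, List.length_nil]
    omega
  | eq x y =>
    obtain rfl : e = true := by cases e <;> simp [fragment, cmpClass, Constraint.cls] at hC ⊢
    refine ⟨(bits y).reverse ++ .var :: ((bits x).reverse ++ .var :: Z),
      runs_step (L := cmpStep true) ?_ (by simp)⟩
    have h₁ := runs_readName (X := encodeTerm (.var y) ++ .eq :: X) (T := T) (Z := Z) x o
      fun S hS => ho S hS x (by simp [Constraint.varList])
    have h₂ := runs_readName (X := .eq :: X) (T := T) (Z := (bits x).reverse ++ .var :: Z) y o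
      fun S hS => ho S hS y (by simp [Constraint.varList])
    simp only [encodeConstraint, List.append_assoc, List.cons_append, List.nil_append]
    refine (h₁.seq_cons (h₂.seq_cons (runs_pop_input (.seq_nil _)))).mono ?_
    simp only [encodeTerm, List.length_append, List.length_cons, List.length_map, List.length_nil]
    omega
  | ne x y hxy =>
    obtain rfl : e = false := by cases e <;> simp [fragment, cmpClass, Constraint.cls] at hC ⊢
    refine ⟨Z, runs_step (L := cmpStep false) ?_ (by simp)⟩
    have h₁ := runs_readName (X := encodeTerm (.var y) ++ .ne :: X) (T := T) (Z := Z) x o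
      fun S hS => ho S hS x (by simp [Constraint.varList])
    have h₂ := runs_readName (X := .ne :: X) (T := T) (Z := (bits x).reverse ++ .var :: Z) y o
      fun S hS => ho S hS y (by simp [Constraint.varList])
    simp only [encodeConstraint, List.append_assoc, List.cons_append, List.nil_append]
    refine (h₁.seq_cons (h₂.seq_cons (runs_pop_input (runs_seq_single (runs_differ hxy))))).mono ?_
    simp only [encodeTerm, List.length_append, List.length_cons, List.length_map, List.length_nil]
    omega

theorem quadratic_le_binary (a b : ℕ) :
    24 * a ^ 2 + (24 * b ^ 2 + (4 * b + 4)) ≤ 24 * (a + (b + 1)) ^ 2 := by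
  nlinarith [Nat.zero_le (a * b), Nat.zero_le a, Nat.zero_le b]

theorem quadratic_le_filter (a k : ℕ) (hk : 1 ≤ k) :
    24 * a ^ 2 + (8 * a + 11 * k) ≤ 24 * (a + k) ^ 2 := by
  nlinarith [Nat.mul_le_mul_left a hk, Nat.mul_le_mul_left k hk]

/-- The main loop can read the pattern `P` in quadratic time, and represent it by the
block `o`. The names recorded on the way are left unspecified. The constant `24` allows the
lengths of all steps to be absorbed by the growth of the square. -/
def Readable (e : Bool) (P : BPattern) (o : Option (List (List Bool))) : Prop :=
  ∀ X T Z, ∃ Z', Runs (step e)∗ (24 * (encodePattern P).length ^ 2)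
    (st [] (encodePattern P ++ X) T Z) (st [] X (encodeBlock o ++ T) Z')

theorem Readable.binary {e : Bool} {P P₁ P₂ : BPattern} {o o₁ o₂ : Option (List (List Bool))}
    (h₁ : Readable e P₁ o₁) (h₂ : Readable e P₂ o₂) {a : Sym}
    (hP : encodePattern P = encodePattern P₁ ++ encodePattern P₂ ++ [a])
    (ho₂ : ∀ S, o₂ = some S → P₂.HasScheme S)
    (h : ∀ X T Z, Runs (step e) (4 * (encodeBlock o₂).length + 4)
      (st [] (a :: X) (encodeBlock o₂ ++ (encodeBlock o₁ ++ T)) Z)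
      (st [] X (encodeBlock o ++ T) Z)) : Readable e P o := by
  intro X T Z
  obtain ⟨Z₁, h₁⟩ := h₁ (encodePattern P₂ ++ a :: X) T Z
  obtain ⟨Z₂, h₂⟩ := h₂ (a :: X) (encodeBlock o₁ ++ T) Z₁
  have := length_encodeBlock_le ho₂
  refine ⟨Z₂, ?_⟩
  rw [hP]
  simp only [List.append_assoc, List.length_append, List.length_singleton]
  exact (h₁.kstar_append (h₂.kstar_append ((h X T Z₂).kstar_single.mono
    (by omega)))).mono (quadratic_le_binary _ _)

/-- A pattern of the fragment can be read as a dead pattern, and as a live pattern with any of its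
schemes. -/
theorem readable {e : Bool} {P : BPattern} (hP : P.InFragment (fragment e))
    (o : Option (List (List Bool))) (ho : ∀ S, o = some S → P.HasScheme S) :
    Readable e P o := by
  induction P generalizing o with
  | triple u v w =>
    intro X T Z
    refine ⟨Z, (runs_step (runs_triple u v w o ho) (by simp)).kstar_single.mono ?_⟩
    have := length_encodePattern_pos (.triple u v w)
    nlinarith
  | union P₁ P₂ h₁ h₂ =>
    have step := fun o₁ o₂ h X T Z => runs_step (e := e)
      (runs_unionStep (X := X) (T := T) (Z := Z) (o := o) (o₁ := o₁) (o₂ := o₂) h) (by simp)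
    by_cases ho' : ∃ S, o = some S ∧ ¬ P₁.HasScheme S
    · obtain ⟨S, rfl, hS⟩ := ho'
      have hS₂ : ∀ S', some S = some S' → P₂.HasScheme S' := fun S' h => by
        cases h
        exact (ho S rfl).resolve_left hS
      exact (h₁ hP.1 none (by simp)).binary (h₂ hP.2 (some S) hS₂) rfl hS₂
        (step _ _ (Or.inr ⟨rfl, by simp, rfl⟩))
    · push Not at ho'
      exact (h₁ hP.1 o ho').binary (h₂ hP.2 none (by simp)) rfl (by simp)
        (step _ _ (Or.inl ⟨rfl, rfl⟩))
  | and P₁ P₂ h₁ h₂ =>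
    have step := fun o₁ o₂ h X T Z => runs_step (e := e)
      (runs_andStep (X := X) (T := T) (Z := Z) (o := o) (o₁ := o₁) (o₂ := o₂) h) (by simp)
    cases o with
    | none =>
      exact (h₁ hP.1 none (by simp)).binary (h₂ hP.2 none (by simp)) rfl (by simp)
        (step _ _ (Or.inl ⟨rfl, rfl, rfl⟩))
    | some S =>
      obtain ⟨S₁, S₂, hS₁, hS₂, rfl⟩ := ho S rfl
      have hS₁' : ∀ S', some S₁ = some S' → P₁.HasScheme S' := fun S' h => by cases h; exact hS₁
      have hS₂' : ∀ S', some S₂ = some S' → P₂.HasScheme S' := fun S' h => by cases h; exact hS₂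
      exact (h₁ hP.1 _ hS₁').binary (h₂ hP.2 _ hS₂') rfl hS₂'
        (step _ _ (Or.inr ⟨S₁, S₂, rfl, rfl, rfl⟩))
  | opt P₁ P₂ h₁ h₂ =>
    have step := fun o₁ o₂ h X T Z => runs_step (e := e)
      (runs_optStep (X := X) (T := T) (Z := Z) (o := o) (o₁ := o₁) (o₂ := o₂) h) (by simp)
    by_cases ho' : ∃ S, o = some S ∧ ¬ P₁.HasScheme S
    · obtain ⟨S, rfl, hS⟩ := ho'
      obtain ⟨S₁, S₂, hS₁, hS₂, rfl⟩ := (ho S rfl).resolve_left hS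
      have hS₁' : ∀ S', some S₁ = some S' → P₁.HasScheme S' := fun S' h => by cases h; exact hS₁
      have hS₂' : ∀ S', some S₂ = some S' → P₂.HasScheme S' := fun S' h => by cases h; exact hS₂
      exact (h₁ hP.1 _ hS₁').binary (h₂ hP.2 _ hS₂') rfl hS₂'
        (step _ _ (Or.inr ⟨S₁, S₂, rfl, rfl, rfl⟩))
    · push Not at ho'
      exact (h₁ hP.1 o ho').binary (h₂ hP.2 none (by simp)) rfl (by simp)
        (step _ _ (Or.inl ⟨rfl, rfl⟩))
  | filter P C h =>
    intro X T Z
    obtain ⟨Z₁, h₁⟩ := h hP.1 o (fun S hS => (ho S hS).1) (encodeConstraint C ++ X) T Z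
    obtain ⟨Z₂, h₂⟩ := runs_filter (X := X) (T := T) (Z := Z₁) hP.2 o fun S hS => (ho S hS).2
    refine ⟨Z₂, ?_⟩
    have h₃ := length_encodeBlock_le (P := P) fun S hS => (ho S hS).1
    have h₄ : 1 ≤ (encodeConstraint C).length := by cases C <;> simp [encodeConstraint] <;> omega
    rw [encodePattern, List.append_assoc, List.length_append]
    exact (h₁.kstar_append h₂.kstar_single).mono
      (le_trans (by omega) (quadratic_le_filter _ _ h₄))

theorem runs_loadInput (x : List Sym) :
    Runs loadInput (2 * x.length + 1) (st x.reverse [] [] []) (st [] x [] []) := by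
  suffices H : ∀ A X, Runs (∑ a : Sym, seq [pop 0 a, push 1 a])∗ (2 * A.length)
      (st A X [] []) (st [] (A.reverse ++ X) [] []) by
    have := H x.reverse []
    rw [List.reverse_reverse, List.append_nil, List.length_reverse] at this
    exact this.seq_cons (runs_empty_aux (.seq_nil _))
  intro A
  induction A with
  | nil => exact fun X => .kstar_nil _ _
  | cons a A ih =>
    intro X
    have := ih (a :: X)
    rw [List.reverse_cons, List.append_assoc, List.singleton_append]
    exact (Runs.kstar_cons (Runs.sum (Finset.mem_univ a)
      (runs_pop_aux (runs_push_input (.seq_nil _)))) this).mono (by simp; omega)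

/-- The program accepts the patterns of the fragment that have a scheme, in quadratic time. -/
theorem runs_program {e : Bool} {P : BPattern} (hP : P.InFragment (fragment e))
    {S : List (List Bool)} (hS : P.HasScheme S) :
    ∃ s, Runs (program e) (24 * (encodePattern P).length ^ 2 + 4 * (encodePattern P).length + 4)
      (initStore (encodePattern P)) s := by
  obtain ⟨Z, h⟩ := readable hP (some S) (fun S' h => by cases h; exact hS) [] [] []
  have hlen := hS.length_le
  have h' := runs_down (A := []) (X := []) (T := []) (Z := Z) S
  simp only [List.append_nil, encodeBlock] at h h'
  rw [initStore_eq]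
  exact ⟨_, ((runs_loadInput _).seq_cons (h.seq_cons (runs_empty_input (runs_pop_main
    (h'.seq_cons (runs_empty_main (.seq_nil _))))))).mono (by omega)⟩

/-- The satisfiability problem for each of the two fragments is in NP. -/
theorem inNP_satLanguage (B : Type*) (e : Bool) : InNP (satLanguage B (fragment e)) := by
  refine inNP_of_program (isRegular_program e)
    (Polynomial.C 24 * Polynomial.X ^ 2 + Polynomial.C 4 * Polynomial.X + Polynomial.C 4) ?_ ?_
  · rintro _ ⟨P, rfl, hP, hsat⟩
    obtain ⟨S, hS⟩ := (satisfiable_iff_exists_hasScheme B hP).1 hsat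
    obtain ⟨s, l, hl, hlen, hex⟩ := runs_program hP hS
    refine ⟨l, hl, ?_, by
      change (execList (initStore (encodePattern P)) l).isSome
      rw [hex]
      rfl⟩
    simpa [patternEncoding] using hlen
  · intro x l hl hex
    obtain ⟨s, hs⟩ := Option.isSome_iff_exists.1 hex
    obtain ⟨P, hx, hP, hS⟩ := exists_of_exec_program ⟨l, hl, hs⟩
    exact ⟨P, hx, hP, (satisfiable_iff_exists_hasScheme B hP).2 hS⟩

end SPARQL

theorem mainTheorem5 (B : Type*) [Infinite B] :
    InNP (SPARQL.satLanguage B {.bound, .eq, .neConst}) ∧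
    InNP (SPARQL.satLanguage B {.bound, .ne, .neConst}) := by
  exact ⟨SPARQL.inNP_satLanguage B true, SPARQL.inNP_satLanguage B false⟩
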